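/- Let $n\ge 0$, let $x_1,x_2,x_3\in\mathbb R$, $\alpha_1,\alpha_2,\alpha_3\in\mathbb C$ and $\tau>0$, and for $z=(z_1,\dots,z_n)\in\mathbb R^n$ put $$\Phi(z)=\prod_{i=1}^n |x_1-z_i|^{\alpha_1-1}|x_2-z_i|^{\alpha_2-1}|x_3-z_i|^{\alpha_3-1}\prod_{1\le j<k\le n}|z_j-z_k|^{2\tau}.$$ Let $\Delta\subset\mathbb R^n$ be a bounded region on which $\Phi$ is absolutely integrable and such that $\Phi$ vanishes on the boundary $\partial\Delta$; at boundary points where some $z_i$ equals some $x_m$, the vanishing of the factor $|x_m-z_i|^{\alpha_m-1}$ is understood by analytic continuation from large $\operatorname{Re}\alpha_m$, so such boundary points are always allowed. (For instance, if $x_1,x_2,x_3$ are $0,1,x$ in some order with $0<x<1$, and $\operatorname{Re}\alpha_1,\operatorname{Re}\alpha_2,\operatorname{Re}\alpha_3>0$, one may take $\Delta=[0,x]^p\times[0,1]^{n-p}$, $0\le p\le n$.) Define $$\langle\phi\rangle=\int_\Delta\phi(z)\Phi(z)\,dz_1\cdots dz_n,\qquad T_{\alpha_1}\langle\phi\rangle=\Big\langle\prod_{l=1}^n(z_l-x_1)\,\phi\Big\rangle,$$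 $$\varphi_i(z)=\prod_{l=1}^{n-i}(x_2-z_l)\prod_{l=n-i+1}^{n}(x_3-z_l),\qquad i=0,1,\dots,n,$$ and write $(a;\tau)_0=1$, $(a;\tau)_k=a(a+\tau)\cdots(a+(k-1)\tau)$ for $k\ge1$. Let $A=LDU$, where $L=(l_{ij})_{0\le i,j\le n}$ is lower triangular, $D=\operatorname{diag}(d_0,\dots,d_n)$ and $U=(u_{ij})_{0\le i,j\le n}$ is upper triangular, with $$l_{ij}=(-1)^{i-j}\binom{n-j}{n-i}\frac{(\alpha_2+j\tau;\tau)_{i-j}}{(\alpha_1+\alpha_2+2j\tau;\tau)_{i-j}}\Big(\frac{x_2-x_1}{x_3-x_1}\Big)^{i-j}\quad(i\ge j),$$ $$d_j=\frac{(\alpha_1;\tau)_j\,(\alpha_1+\alpha_2+2j\tau;\tau)_{n-j}\,(x_2-x_1)^j(x_3-x_1)^{n-j}}{(\alpha_1+\alpha_2+(j-1)\tau;\tau)_j\,(\alpha_1+\alpha_2+\alpha_3+(n+j-1)\tau;\tau)_{n-j}},$$ $$u_{ij}=(-1)^{j-i}\binom{j}{i}\frac{(\alpha_3+(n-j)\tau;\tau)_{j-i}}{(\alpha_1+\alpha_2+2i\tau;\tau)_{j-i}}\quad(i\le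 j).$$ Assume that no denominator vanishes, i.e. $x_3\ne x_1$, $\alpha_1+\alpha_2+s\tau\ne0$ for integers $0\le s\le 2n-2$, and $\alpha_1+\alpha_2+\alpha_3+s\tau\neq 0$ for integers $s\ge 0$ with $n-1\le s\le 2n-2$. Then: 1. If $\Delta$ is invariant under permutations of the coordinates $z_1,\dots,z_n$, then $$(T_{\alpha_1}\langle\varphi_0\rangle,\dots,T_{\alpha_1}\langle\varphi_n\rangle)=(\langle\varphi_0\rangle,\dots,\langle\varphi_n\rangle)\,A.$$ 2. For every $\Delta$ as above, invariant or not, the same system holds with each $\varphi_i$ replaced by its symmetrization $\frac1{n!}\sum_{\sigma\in\mathfrak S_n}\varphi_i(z_{\sigma(1)},\dots,z_{\sigma(n)})$: $$(T_{\alpha_1}\langle\tilde\varphi_0\rangle,\dots,T_{\alpha_1}\langle\tilde\varphi_n\rangle)=(\langle\tilde\varphi_0\rangle,\dots,\langle\tilde\varphi_n\rangle)\,A,\qquad \tilde\varphi_i=\frac1{n!}\sum_{\sigma\in\mathfrak S_n}\varphi_i(z_{\sigma(1)},\dots,z_{\sigma(n)}).$$ -/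

import Mathlib

open MeasureTheory

noncomputable section

/-- The numerical data of a generalized Selberg density: three real points `x₁, x₂, x₃`,
three complex exponents `α₁, α₂, α₃` and the real coupling `τ`. -/
structure SelbergParams where
  x₁ : ℝ
  x₂ : ℝ
  x₃ : ℝ
  α₁ : ℂ
  α₂ : ℂ
  α₃ : ℂ
  τ : ℝ

/-- `(a; t)_k = a (a + t) (a + 2t) ⋯ (a + (k-1)t)`, with `(a; t)_0 = 1`. -/
def stepPoch (a t : ℂ) (k : ℕ) : ℂ := ∏ s ∈ Finset.range k, (a + (s : ℂ) * t)

/-- The symmetrization `z ↦ (1/n!) ∑_σ φ(z_{σ(1)}, …, z_{σ(n)})` of a function of `n` variables. -/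
def symmetrize {n : ℕ} (φ : (Fin n → ℝ) → ℂ) (z : Fin n → ℝ) : ℂ :=
  ((n.factorial : ℂ))⁻¹ * ∑ σ : Equiv.Perm (Fin n), φ (fun l => z (σ l))

namespace SelbergParams

variable (P : SelbergParams) {n : ℕ}

/-- The generalized Selberg density
`∏_i |x₁ - z_i|^(α₁-1) |x₂ - z_i|^(α₂-1) |x₃ - z_i|^(α₃-1) ∏_{j<k} |z_j - z_k|^(2τ)`. -/
def density (z : Fin n → ℝ) : ℂ :=
  (∏ i, ((|P.x₁ - z i| : ℝ) : ℂ) ^ (P.α₁ - 1) * ((|P.x₂ - z i| : ℝ) : ℂ) ^ (P.α₂ - 1) *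
      ((|P.x₃ - z i| : ℝ) : ℂ) ^ (P.α₃ - 1)) *
    ((∏ j, ∏ k ∈ Finset.Ioi j, |z j - z k| ^ (2 * P.τ) : ℝ) : ℂ)

/-- The (unnormalized) average `⟨φ⟩ = ∫_Δ φ(z) Φ(z) dz₁ ⋯ dz_n`. -/
def average (Δ : Set (Fin n → ℝ)) (φ : (Fin n → ℝ) → ℂ) : ℂ :=
  ∫ z in Δ, φ z * P.density z

/-- The shifted average `T_{α₁}⟨φ⟩ = ⟨∏_l (z_l - x₁) φ⟩`. -/
def shiftedAverage (Δ : Set (Fin n → ℝ)) (φ : (Fin n → ℝ) → ℂ) : ℂ :=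
  P.average Δ (fun z => (∏ l, ((z l - P.x₁ : ℝ) : ℂ)) * φ z)

/-- `φ_i(z) = (x₂ - z₁) ⋯ (x₂ - z_{n-i}) (x₃ - z_{n-i+1}) ⋯ (x₃ - z_n)`; the coordinates are
numbered from `0` in the code, so that `z_1, …, z_{n-i}` are those with `l + i < n`. -/
def phi (i : ℕ) (z : Fin n → ℝ) : ℂ :=
  ∏ l : Fin n, if (l : ℕ) + i < n then ((P.x₂ - z l : ℝ) : ℂ) else ((P.x₃ - z l : ℝ) : ℂ)

/-- The density `Φ` vanishes on the boundary of `Δ`. At a boundary point where a coordinate equals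
one of the `x_m`, the vanishing is that of the factor `|x_m - z_i|^(α_m - 1)`, understood by
continuation from large `Re α_m`, so that small values of `Re α_m > 0` are not excluded. -/
def VanishesOnBoundary (Δ : Set (Fin n → ℝ)) : Prop :=
  ∀ z ∈ frontier Δ, P.density z = 0 ∨ ∃ i, z i = P.x₁ ∨ z i = P.x₂ ∨ z i = P.x₃

/-- None of the denominators in the matrices below is zero: `x₃ ≠ x₁`, `α₁ + α₂ + sτ ≠ 0` for
`0 ≤ s ≤ 2n-2`, and `α₁ + α₂ + α₃ + sτ ≠ 0` for `n-1 ≤ s ≤ 2n-2`. -/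
def DenominatorsNonzero (n : ℕ) : Prop :=
  P.x₃ ≠ P.x₁ ∧
  (∀ s : ℕ, s + 2 ≤ 2 * n → P.α₁ + P.α₂ + (s : ℂ) * P.τ ≠ 0) ∧
  (∀ s : ℕ, n ≤ s + 1 → s + 2 ≤ 2 * n → P.α₁ + P.α₂ + P.α₃ + (s : ℂ) * P.τ ≠ 0)

/-- The lower triangular factor. -/
def matL (n : ℕ) : Matrix (Fin (n + 1)) (Fin (n + 1)) ℂ := fun i j =>
  if j ≤ i then
    (-1) ^ ((i : ℕ) - (j : ℕ)) * (((n - (j : ℕ)).choose (n - (i : ℕ)) : ℕ) : ℂ) *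
      (stepPoch (P.α₂ + ((j : ℕ) : ℂ) * P.τ) P.τ ((i : ℕ) - (j : ℕ)) /
        stepPoch (P.α₁ + P.α₂ + 2 * ((j : ℕ) : ℂ) * P.τ) P.τ ((i : ℕ) - (j : ℕ))) *
      (((P.x₂ - P.x₁) / (P.x₃ - P.x₁) : ℝ) : ℂ) ^ ((i : ℕ) - (j : ℕ))
  else 0

/-- The entries of the diagonal factor. -/
def diagEntry (n : ℕ) (j : Fin (n + 1)) : ℂ :=
  (stepPoch P.α₁ P.τ (j : ℕ) * stepPoch (P.α₁ + P.α₂ + 2 * ((j : ℕ) : ℂ) * P.τ) P.τ (n - (j : ℕ)) *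
      ((P.x₂ - P.x₁ : ℝ) : ℂ) ^ (j : ℕ) * ((P.x₃ - P.x₁ : ℝ) : ℂ) ^ (n - (j : ℕ))) /
    (stepPoch (P.α₁ + P.α₂ + (((j : ℕ) : ℂ) - 1) * P.τ) P.τ (j : ℕ) *
      stepPoch (P.α₁ + P.α₂ + P.α₃ + ((n : ℂ) + ((j : ℕ) : ℂ) - 1) * P.τ) P.τ (n - (j : ℕ)))

/-- The diagonal factor. -/
def matD (n : ℕ) : Matrix (Fin (n + 1)) (Fin (n + 1)) ℂ := Matrix.diagonal (P.diagEntry n)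

/-- The upper triangular factor. -/
def matU (n : ℕ) : Matrix (Fin (n + 1)) (Fin (n + 1)) ℂ := fun i j =>
  if i ≤ j then
    (-1) ^ ((j : ℕ) - (i : ℕ)) * (((j : ℕ).choose (i : ℕ) : ℕ) : ℂ) *
      (stepPoch (P.α₃ + ((n : ℂ) - ((j : ℕ) : ℂ)) * P.τ) P.τ ((j : ℕ) - (i : ℕ)) /
        stepPoch (P.α₁ + P.α₂ + 2 * ((i : ℕ) : ℂ) * P.τ) P.τ ((j : ℕ) - (i : ℕ)))
  else 0

/-- The matrix `A = L D U` of the difference system. -/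
def matA (n : ℕ) : Matrix (Fin (n + 1)) (Fin (n + 1)) ℂ := P.matL n * P.matD n * P.matU n

end SelbergParams

end

noncomputable section

open scoped Topology
open Filter

/-! Write a = z - x₁, b = x₂ - z, c = x₃ - z. After symmetrization every integrand is a sum over
permutations of products of factors `ab`, `ac`, `b`, `c`, so its average depends only on four
multiplicities; call it f(p, q, s, t). Up to the common factor 1/n!, the averages of φᵢ are f(0, 0,
n-i, i), the shifted ones f(n-i, i, 0, 0).

Relations among these come from a divergence. Put abc in one slot and arbitrary spectator factors in
the others, differentiate in the coordinate of that slot, and sum over all permutations. The poles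
along zⱼ = zₖ cancel between a permutation and its composite with a transposition
(`sum_tangentField_div`), so the divergence against Φ is a polynomial times Φ. Its integral
vanishes, which relates `bc`, `ac` and `ab` with the same spectators (`average_symProd_relation`).
Eliminating `bc` by bc = (x₂ - x₁)c - ac = (x₃ - x₁)b - ab leaves `BlockRelations`.

Φ may blow up at the boundary, so the vanishing of boundary terms needs an argument. The boundary
lies in the zero set of the arrangement polynomial Q, and the field is tangent to it: the derivative
of Q along the field is Q times a polynomial. Inserting a cutoff in Q/ε therefore costs an error
bounded by a constant times |Φ|, uniformly in ε, and tending to 0 almost everywhere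
(`setIntegral_divergence_eq_zero`). Tangency is the divergence computation again, with all exponents
equal to 1.

The factorization A = LDU reflects the intermediate family f(n-k, 0, 0, k). For q = 0 the relations
replace an `ab` by `b` or `c`; iterating from the intermediate family gives LD (`lower_expansion`).
For s = 0 they replace an `ac` by `c` or `ab`; iterating down to the intermediate family gives U
(`upper_expansion`). Both iterations are sums over lattice paths with closed forms that follow from
Pascal's rule. On an invariant region, symmetrizing an integrand does not change its average, so the
first claim follows from the second. -/

theorem eventually_abs_div_lt_one {X : Type*} [TopologicalSpace X] {Q : X → ℝ}
    (hQ : Continuous Q) (ε : ℝ) {z : X}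
    (hz : Q z = 0) : ∀ᶠ y in 𝓝 z, |Q y / ε| < 1 := by
  have : Continuous fun y => |Q y / ε| := (hQ.div_const ε).abs
  exact this.continuousAt.eventually_lt continuousAt_const (by simp [hz])

/-- The poles of `f` lie on `Q = 0`, and `h (Q / ε)` is identically zero near that set, so the
product extends continuously by 0. -/
theorem continuous_cutoff_mul {X : Type*} [TopologicalSpace X] {Q : X → ℝ}
    (hQ : Continuous Q) {h : ℝ → ℝ} (hh : Continuous h)
    (h0 : ∀ t, |t| < 1 → h t = 0) {f : X → ℂ} (hf : ContinuousOn f {z | Q z ≠ 0})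
    (ε : ℝ) : Continuous fun z => (h (Q z / ε) : ℂ) * f z := by
  rw [continuous_iff_continuousAt]
  intro z
  by_cases hz : Q z = 0
  · refine (continuousAt_const (y := (0 : ℂ))).congr ?_
    filter_upwards [eventually_abs_div_lt_one hQ ε hz] with y hy
    simp [h0 _ hy]
  · have hopen : IsOpen {z | Q z ≠ 0} := isOpen_ne_fun hQ continuous_const
    exact (Complex.continuous_ofReal.comp (hh.comp (hQ.div_const ε))).continuousAt.mul
      (hf.continuousAt (hopen.mem_nhds hz))

theorem exists_norm_le_of_isBounded {E : Type*} [PseudoMetricSpace E] [ProperSpace E]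
    {U : Set E} (hU : Bornology.IsBounded U) {f : E → ℂ}
    (hf : Continuous f) : ∃ C, ∀ z ∈ U, ‖f z‖ ≤ C := by
  obtain ⟨C, hC⟩ := hU.isCompact_closure.exists_bound_of_continuousOn hf.continuousOn
  exact ⟨C, fun z hz => hC z (subset_closure hz)⟩

/-! ### Divergence theorem for fields tangent to a zero set -/

section Divergence

variable {E : Type*} [NormedAddCommGroup E] [NormedSpace ℝ E] [FiniteDimensional ℝ E]
  [MeasurableSpace E] [BorelSpace E] {μ : Measure E}

/-- Integration by parts against the constant 1. The derivative must exist at every point, so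
singularities have to be cut off beforehand. -/
theorem integral_eq_zero_of_hasLineDerivAt [μ.IsAddHaarMeasure] {g g' : E → ℂ} {v : E}
    (hg : Integrable g μ) (hg' : Integrable g' μ) (h : ∀ z, HasLineDerivAt ℝ g (g' z) z v) :
    ∫ z, g' z ∂μ = 0 := by
  have := integral_bilinear_hasLineDerivAt_right_eq_neg_left_of_integrable (μ := μ)
    (f := fun _ : E => (1 : ℂ)) (f' := fun _ => 0) (g := g) (g' := g') (v := v)
    (B := ContinuousLinearMap.mul ℝ ℂ) (by simp) (by simpa using hg') (by simpa using hg)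
    (fun z _ => by simpa [HasLineDerivAt] using hasDerivAt_const (0 : ℝ) (1 : ℂ)) (fun z _ => h z)
  simpa using this

theorem IntegrableOn.continuous_mul_of_isBounded {U : Set E} (hUm : MeasurableSet U)
    (hU : Bornology.IsBounded U) {f Φ : E → ℂ} (hf : Continuous f) (hΦ : IntegrableOn Φ U μ) :
    IntegrableOn (fun z => f z * Φ z) U μ := by
  obtain ⟨C, hC⟩ := exists_norm_le_of_isBounded hU hf
  exact hΦ.bdd_mul (c := C) hf.aestronglyMeasurable
    ((ae_restrict_iff' hUm).2 (Eventually.of_forall hC))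

/-- A smooth even function that vanishes on `[-1, 1]` and is `1` outside `[-2, 2]`. -/
def cutoff (t : ℝ) : ℝ := Real.smoothTransition (t ^ 2 - 1)

theorem contDiff_cutoff : ContDiff ℝ 1 cutoff :=
  Real.smoothTransition.contDiff.comp ((contDiff_id.pow 2).sub contDiff_const)

theorem cutoff_eq_zero {t : ℝ} (ht : |t| < 1) : cutoff t = 0 :=
  Real.smoothTransition.zero_of_nonpos (by nlinarith [sq_abs t, abs_nonneg t])

theorem cutoff_eq_one {t : ℝ} (ht : 2 < |t|) : cutoff t = 1 :=
  Real.smoothTransition.one_of_one_le (by nlinarith [sq_abs t, abs_nonneg t])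

theorem deriv_cutoff_eq_zero_of_lt {t : ℝ} (ht : |t| < 1) : deriv cutoff t = 0 := by
  have : cutoff =ᶠ[𝓝 t] fun _ => 0 := by
    filter_upwards [continuous_abs.continuousAt.eventually_lt continuousAt_const ht] with y hy
      using cutoff_eq_zero hy
  simpa using this.deriv_eq

theorem deriv_cutoff_eq_zero_of_gt {t : ℝ} (ht : 2 < |t|) : deriv cutoff t = 0 := by
  have : cutoff =ᶠ[𝓝 t] fun _ => 1 := by
    filter_upwards [continuousAt_const.eventually_lt continuous_abs.continuousAt ht] with y hy
      using cutoff_eq_one hy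
  simpa using this.deriv_eq

theorem continuous_deriv_cutoff : Continuous (deriv cutoff) :=
  contDiff_cutoff.continuous_deriv le_rfl

/-- This bound makes the cutoff error uniform in ε: the derivative of `cutoff (Q / ε)` along a
tangent field is `deriv cutoff (Q / ε) * (Q / ε)` times a bounded function. -/
theorem exists_mul_deriv_cutoff_le : ∃ C, 0 ≤ C ∧ ∀ t, |deriv cutoff t * t| ≤ C := by
  obtain ⟨C, hC⟩ := (isCompact_Icc (a := (-2 : ℝ)) (b := 2)).exists_bound_of_continuousOn
    (continuous_deriv_cutoff.mul continuous_id).continuousOn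
  have h0 : 0 ≤ C := (norm_nonneg _).trans (hC 0 (by norm_num))
  refine ⟨C, h0, fun t => ?_⟩
  by_cases ht : 2 < |t|
  · simpa [deriv_cutoff_eq_zero_of_gt ht] using h0
  · exact hC t (abs_le.1 (not_lt.1 ht))

/-- The divergence theorem on a bounded open set `U` whose boundary lies in the zero set of `Q`,
for the product of a density `Φ` and a vector field `∑ₛ gₛ vₛ` that is tangent to that zero set. The
divergence of the product is `D Φ`, and no boundedness of `Φ` near the boundary is needed. -/
theorem setIntegral_divergence_eq_zero [μ.IsAddHaarMeasure] {ι : Type*} [Fintype ι] {U : Set E}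
    (hU : IsOpen U) (hUb : Bornology.IsBounded U) {Q : E → ℝ} (hQ : Continuous Q)
    (hQ0 : ∀ᵐ z ∂μ, Q z ≠ 0) (hfr : ∀ z ∈ frontier U, Q z = 0)
    {Φ : E → ℂ} (hΦ : IntegrableOn Φ U μ) {v : ι → E} {g dg ℓ m : ι → E → ℂ} {D K : E → ℂ}
    (hQ' : ∀ s z, Q z ≠ 0 → HasLineDerivAt ℝ (fun z => (Q z : ℂ)) (Q z * m s z) z (v s))
    (hm : ∀ s, ContinuousOn (m s) {z | Q z ≠ 0})
    (hΦ' : ∀ s z, Q z ≠ 0 → HasLineDerivAt ℝ Φ (Φ z * ℓ s z) z (v s))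
    (hℓ : ∀ s, ContinuousOn (ℓ s) {z | Q z ≠ 0})
    (hg' : ∀ s z, HasLineDerivAt ℝ (g s) (dg s z) z (v s))
    (hg : ∀ s, Continuous (g s)) (hdg : ∀ s, Continuous (dg s))
    (hD : Continuous D) (hK : Continuous K)
    (hD' : ∀ z, Q z ≠ 0 → ∑ s, (dg s z + g s z * ℓ s z) = D z)
    (hK' : ∀ z, Q z ≠ 0 → ∑ s, g s z * m s z = K z) :
    ∫ z in U, D z * Φ z ∂μ = 0 := by
  have hUm := hU.measurableSet
  -- `b ε s * Φ` is the derivative of `cutoff (Q / ε) * g s * Φ` along `v s`. Each `m s` and `ℓ s`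
  -- may have poles; only the sums over `s` are regular.
  set b : ℝ → ι → E → ℂ := fun ε s z =>
    ((deriv cutoff (Q z / ε) * (Q z / ε) : ℝ) : ℂ) * (g s z * m s z) +
      (cutoff (Q z / ε) : ℂ) * (dg s z + g s z * ℓ s z) with hb
  have hcut1 : ∀ t, |t| < 1 → deriv cutoff t * t = 0 := fun t ht => by
    simp [deriv_cutoff_eq_zero_of_lt ht]
  have hb_cont : ∀ ε, ∀ s, Continuous (b ε s) := fun ε s =>
    (continuous_cutoff_mul hQ (continuous_deriv_cutoff.mul continuous_id) hcut1
      ((hg s).continuousOn.mul (hm s)) ε).add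
    (continuous_cutoff_mul hQ contDiff_cutoff.continuous (fun t ht => cutoff_eq_zero ht)
      ((hdg s).continuousOn.add ((hg s).continuousOn.mul (hℓ s))) ε)
  have hb_int : ∀ ε, ∀ s, IntegrableOn (fun z => b ε s z * Φ z) U μ := fun ε s =>
    IntegrableOn.continuous_mul_of_isBounded hUm hUb (hb_cont ε s) hΦ
  have hb_zero : ∀ ε, ∀ s, ∫ z in U, b ε s z * Φ z ∂μ = 0 := by
    intro ε s
    rw [← integral_indicator hUm]
    have hw : IntegrableOn (fun z => ((cutoff (Q z / ε) : ℂ) * g s z) * Φ z) U μ :=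
      IntegrableOn.continuous_mul_of_isBounded hUm hUb
        (continuous_cutoff_mul hQ contDiff_cutoff.continuous (fun t ht => cutoff_eq_zero ht)
          (hg s).continuousOn ε) hΦ
    refine integral_eq_zero_of_hasLineDerivAt (v := v s) (hw.integrable_indicator hUm)
      ((hb_int ε s).integrable_indicator hUm) fun z => ?_
    have hline : Tendsto (fun t : ℝ => z + t • v s) (𝓝 0) (𝓝 z) := by
      have : Continuous fun t : ℝ => z + t • v s := by fun_prop
      simpa using this.tendsto 0
    by_cases hz : Q z = 0
    · have h1 : U.indicator (fun z => b ε s z * Φ z) z = 0 := by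
        simp [hb, hz, cutoff_eq_zero]
      rw [h1]
      refine (hasDerivAt_const (0 : ℝ) (0 : ℂ)).congr_of_eventuallyEq ?_
      filter_upwards [hline.eventually (eventually_abs_div_lt_one hQ ε hz)] with t ht
      simp [cutoff_eq_zero ht]
    · by_cases hzU : z ∈ U
      · rw [Set.indicator_of_mem hzU]
        have hd1 : HasDerivAt (fun t : ℝ => (cutoff (Q (z + t • v s) / ε) : ℂ))
            (((deriv cutoff (Q z / ε) * (Q z / ε) : ℝ) : ℂ) * m s z) 0 := by
          -- `cutoff` takes a real argument, while the derivative of `Q` is given as a complex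
          -- number; its real part is the real derivative, and `h1'` shows that nothing is lost.
          have h1 : HasDerivAt (fun t : ℝ => Q (z + t • v s)) (Q z * m s z).re 0 := by
            simpa using! (Complex.reCLM.hasFDerivAt.comp_hasDerivAt 0 (hQ' s z hz))
          have h1' : ((Q z * m s z).re : ℂ) = Q z * m s z :=
            (h1.ofReal_comp).unique (hQ' s z hz)
          have h2 : HasDerivAt cutoff (deriv cutoff (Q z / ε)) (Q (z + (0 : ℝ) • v s) / ε) := by
            simpa using (contDiff_cutoff.differentiable (by norm_num) (Q z / ε)).hasDerivAt
          have h3 := (h2.comp 0 (h1.div_const ε)).ofReal_comp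
          refine h3.congr_deriv ?_
          rw [Complex.ofReal_mul, Complex.ofReal_div, h1']
          push_cast
          ring
        have hd := (hd1.mul (hg' s z)).mul (hΦ' s z hz)
        have hd' : HasDerivAt (fun t : ℝ => (cutoff (Q (z + t • v s) / ε) : ℂ) *
            g s (z + t • v s) * Φ (z + t • v s)) (b ε s z * Φ z) 0 := by
          refine hd.congr_deriv ?_
          simp only [hb, zero_smul, add_zero, Pi.mul_apply]
          ring
        refine hd'.congr_of_eventuallyEq ?_
        filter_upwards [hline.eventually (hU.mem_nhds hzU)] with t ht
        rw [Set.indicator_of_mem ht]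
      · rw [Set.indicator_of_notMem hzU]
        -- A point with `Q z ≠ 0` is not on the frontier, so outside `U` the indicator vanishes in a
        -- whole neighbourhood.
        have hzc : z ∈ (closure U)ᶜ := fun hc => hz (hfr z ⟨hc, by rwa [hU.interior_eq]⟩)
        refine (hasDerivAt_const (0 : ℝ) (0 : ℂ)).congr_of_eventuallyEq ?_
        filter_upwards [hline.eventually (isClosed_closure.isOpen_compl.mem_nhds hzc)] with t ht
        exact Set.indicator_of_notMem (fun h => ht (subset_closure h)) _
  -- Only after summation over `s` do the singular coefficients combine into the continuous `K` and
  -- `D`, for which bounds independent of ε exist.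
  have hsum : ∀ ε, ∫ z in U, (((deriv cutoff (Q z / ε) * (Q z / ε) : ℝ) : ℂ) * K z +
      (cutoff (Q z / ε) : ℂ) * D z) * Φ z ∂μ = 0 := by
    intro ε
    have h1 : ∫ z in U, ∑ s, b ε s z * Φ z ∂μ = 0 := by
      rw [integral_finsetSum _ fun s _ => hb_int ε s]
      exact Finset.sum_eq_zero fun s _ => hb_zero ε s
    rw [← h1]
    refine integral_congr_ae (ae_restrict_of_ae ?_)
    filter_upwards [hQ0] with z hz
    rw [← hK' z hz, ← hD' z hz, ← Finset.sum_mul]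
    simp only [hb, Finset.sum_add_distrib, Finset.mul_sum, mul_add]
  obtain ⟨C, hC0, hC⟩ := exists_mul_deriv_cutoff_le
  obtain ⟨CD, hCD⟩ := exists_norm_le_of_isBounded hUb hD
  obtain ⟨CK, hCK⟩ := exists_norm_le_of_isBounded hUb hK
  -- Take ε = 1/(N+1). Where `Q z ≠ 0`, eventually |Q z|/ε > 2, so the cutoff is 1 and its
  -- derivative is 0.
  have hlim : Tendsto (fun N : ℕ => ∫ z in U,
      (((deriv cutoff (Q z / (1 / ((N : ℝ) + 1))) * (Q z / (1 / ((N : ℝ) + 1))) : ℝ) : ℂ) * K z +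
      (cutoff (Q z / (1 / ((N : ℝ) + 1))) : ℂ) * D z) * Φ z ∂μ) atTop
      (𝓝 (∫ z in U, D z * Φ z ∂μ)) := by
    refine tendsto_integral_of_dominated_convergence (fun z => (C * CK + CD) * ‖Φ z‖) ?_
      (hΦ.norm.const_mul _) ?_ ?_
    · intro N
      refine AEStronglyMeasurable.mul (Continuous.aestronglyMeasurable ?_) hΦ.aestronglyMeasurable
      have hc := continuous_deriv_cutoff
      have hc' := contDiff_cutoff.continuous
      have hd : Continuous fun z => Q z / (1 / ((N : ℝ) + 1)) := hQ.div_const _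
      exact ((Complex.continuous_ofReal.comp ((hc.comp hd).mul hd)).mul hK).add
        ((Complex.continuous_ofReal.comp (hc'.comp hd)).mul hD)
    · intro N
      refine (ae_restrict_iff' hUm).2 (Eventually.of_forall fun z hz => ?_)
      rw [norm_mul]
      refine mul_le_mul_of_nonneg_right ((norm_add_le _ _).trans (add_le_add ?_ ?_))
        (norm_nonneg _)
      · rw [norm_mul, Complex.norm_real]
        exact mul_le_mul (hC _) (hCK z hz) (norm_nonneg _) hC0
      · rw [norm_mul, Complex.norm_real, cutoff,
          Real.norm_of_nonneg (Real.smoothTransition.nonneg _)]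
        exact (mul_le_of_le_one_left (norm_nonneg _) (Real.smoothTransition.le_one _)).trans
          (hCD z hz)
    · refine ae_restrict_of_ae ?_
      filter_upwards [hQ0] with z hz
      refine tendsto_const_nhds.congr' ?_
      have hinf : Tendsto (fun N : ℕ => |Q z| * ((N : ℝ) + 1)) atTop atTop :=
        (tendsto_natCast_atTop_atTop.atTop_add tendsto_const_nhds).const_mul_atTop
          (abs_pos.2 hz)
      filter_upwards [hinf.eventually_gt_atTop 2] with N hN
      have hN' : 2 < |Q z / (1 / ((N : ℝ) + 1))| := by
        rw [div_div_eq_mul_div, div_one, abs_mul, abs_of_nonneg (by positivity : (0 : ℝ) ≤ N + 1)]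
        exact hN
      simp [-one_div, deriv_cutoff_eq_zero_of_gt hN', cutoff_eq_one hN']
  refine tendsto_nhds_unique hlim (tendsto_const_nhds.congr fun N => ?_)
  exact (hsum _).symm

end Divergence

/-! ### The arrangement and logarithmic derivatives -/

namespace SelbergParams

variable (P : SelbergParams) {n : ℕ}

/-- The products of at most two of `z - x₁`, `x₂ - z`, `x₃ - z` that occur in the difference
system. -/
inductive Factor where
  | ab | ac | bc | b | c
  deriving DecidableEq

/-- The linear factor `z - x₁`. -/
def linA (t : ℝ) : ℂ := ((t - P.x₁ : ℝ) : ℂ)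

/-- The linear factor `x₂ - z`. -/
def linB (t : ℝ) : ℂ := ((P.x₂ - t : ℝ) : ℂ)

/-- The linear factor `x₃ - z`. -/
def linC (t : ℝ) : ℂ := ((P.x₃ - t : ℝ) : ℂ)

/-- The value of a factor at a real point. -/
def val : Factor → ℝ → ℂ
  | .ab, t => P.linA t * P.linB t
  | .ac, t => P.linA t * P.linC t
  | .bc, t => P.linB t * P.linC t
  | .b, t => P.linB t
  | .c, t => P.linC t

/-- The sum over all permutations of the coordinates of the product of the factors `w l`. -/
def symProd (w : Fin n → Factor) (z : Fin n → ℝ) : ℂ :=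
  ∑ σ : Equiv.Perm (Fin n), ∏ l, P.val (w l) (z (σ l))

/-- The logarithmic derivative in the `i`-th coordinate of
`∏ |x₁ - zᵢ|^c₁ |x₂ - zᵢ|^c₂ |x₃ - zᵢ|^c₃ ∏ |zⱼ - zₖ|^κ`. -/
def logDer (c₁ c₂ c₃ κ : ℂ) (i : Fin n) (z : Fin n → ℝ) : ℂ :=
  (c₁ / ((z i - P.x₁ : ℝ) : ℂ) + c₂ / ((z i - P.x₂ : ℝ) : ℂ) + c₃ / ((z i - P.x₃ : ℝ) : ℂ)) +
    ∑ k ∈ Finset.univ.erase i, κ / ((z i - z k : ℝ) : ℂ)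

/-- The polynomial whose zero set is the arrangement `zᵢ = xₘ`, `zⱼ = zₖ`. -/
def arrangement (z : Fin n → ℝ) : ℝ :=
  (∏ i, (P.x₁ - z i) * (P.x₂ - z i) * (P.x₃ - z i)) * ∏ j, ∏ k ∈ Finset.Ioi j, (z j - z k)

theorem arrangement_ne_zero_iff {z : Fin n → ℝ} : P.arrangement z ≠ 0 ↔
    (∀ i, z i ≠ P.x₁ ∧ z i ≠ P.x₂ ∧ z i ≠ P.x₃) ∧ ∀ i k, i ≠ k → z i ≠ z k := by
  simp only [arrangement, mul_ne_zero_iff, Finset.prod_ne_zero_iff, Finset.mem_univ, true_imp_iff,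
    Finset.mem_Ioi, sub_ne_zero]
  constructor
  · rintro ⟨h1, h2⟩
    refine ⟨fun i => ⟨(h1 i).1.1.symm, (h1 i).1.2.symm, (h1 i).2.symm⟩, fun i k hik => ?_⟩
    rcases lt_or_gt_of_ne hik with h | h
    · exact h2 i k h
    · exact (h2 k i h).symm
  · rintro ⟨h1, h2⟩
    exact ⟨fun i => ⟨⟨(h1 i).1.symm, (h1 i).2.1.symm⟩, (h1 i).2.2.symm⟩,
      fun j k hjk => h2 j k hjk.ne⟩

theorem continuous_arrangement : Continuous (P.arrangement (n := n)) := by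
  unfold arrangement
  fun_prop

theorem ae_arrangement_ne_zero : ∀ᵐ z : Fin n → ℝ, P.arrangement z ≠ 0 := by
  have h1 : ∀ (x : ℝ) (i : Fin n), ∀ᵐ z : Fin n → ℝ, z i ≠ x := fun x i =>
    Measure.ae_eval_ne (μ := fun _ : Fin n => (volume : Measure ℝ)) i x
  have h2 : ∀ i k : Fin n, i ≠ k → ∀ᵐ z : Fin n → ℝ, z i ≠ z k := by
    intro i k hik
    let f : (Fin n → ℝ) →ₗ[ℝ] ℝ := LinearMap.proj (R := ℝ) (φ := fun _ => ℝ) i - LinearMap.proj k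
    have hf : LinearMap.ker f ≠ ⊤ := by
      intro h
      have : (Pi.single i 1 : Fin n → ℝ) ∈ LinearMap.ker f := h ▸ Submodule.mem_top
      simp [f, hik.symm] at this
    have h0 := Measure.addHaar_submodule (volume : Measure (Fin n → ℝ)) _ hf
    rw [ae_iff]
    refine measure_mono_null (fun z hz => ?_) h0
    have hz' : z i = z k := by simpa using hz
    simp [f, hz']
  have h2' : ∀ i k : Fin n, ∀ᵐ z : Fin n → ℝ, i ≠ k → z i ≠ z k := by
    intro i k
    by_cases hik : i = k
    · simp [hik]
    · filter_upwards [h2 i k hik] with z hz _ using hz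
  filter_upwards [ae_all_iff.2 (h1 P.x₁), ae_all_iff.2 (h1 P.x₂), ae_all_iff.2 (h1 P.x₃),
    ae_all_iff.2 fun i => ae_all_iff.2 (h2' i)] with z a1 a2 a3 a4
  exact P.arrangement_ne_zero_iff.2 ⟨fun i => ⟨a1 i, a2 i, a3 i⟩, a4⟩

theorem continuousOn_logDer (c₁ c₂ c₃ κ : ℂ) (i : Fin n) :
    ContinuousOn (P.logDer c₁ c₂ c₃ κ i) {z | P.arrangement z ≠ 0} := by
  have key : ∀ (c : ℂ) (f : (Fin n → ℝ) → ℝ), Continuous f →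
      (∀ z, P.arrangement z ≠ 0 → f z ≠ 0) →
      ContinuousOn (fun z => c / ((f z : ℝ) : ℂ)) {z | P.arrangement z ≠ 0} := fun c f hf h0 =>
    continuousOn_const.div (Complex.continuous_ofReal.comp hf).continuousOn
      fun z hz => Complex.ofReal_ne_zero.2 (h0 z hz)
  unfold logDer
  refine ((((key _ _ (by fun_prop) fun z hz => ?_).add
    (key _ _ (by fun_prop) fun z hz => ?_)).add (key _ _ (by fun_prop) fun z hz => ?_)).add
    (continuousOn_finsetSum _ fun k hk => key _ _ (by fun_prop) fun z hz => ?_)) <;>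
  rw [P.arrangement_ne_zero_iff] at hz <;> rw [sub_ne_zero]
  exacts [(hz.1 i).1, (hz.1 i).2.1, (hz.1 i).2.2, hz.2 i k (Finset.ne_of_mem_erase hk).symm]

theorem hasDerivAt_prod_of_logDeriv {ι : Type*} (s : Finset ι) {f : ι → ℝ → ℂ} {l : ι → ℂ} {t : ℝ}
    (h : ∀ i ∈ s, HasDerivAt (f i) (f i t * l i) t) :
    HasDerivAt (fun y => ∏ i ∈ s, f i y) ((∏ i ∈ s, f i t) * ∑ i ∈ s, l i) t := by
  classical
  induction s using Finset.induction_on with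
  | empty => simpa using hasDerivAt_const t (1 : ℂ)
  | insert a s ha ih =>
    simp only [Finset.prod_insert ha, Finset.sum_insert ha]
    refine ((h a (Finset.mem_insert_self a s)).fun_mul
      (ih fun i hi => h i (Finset.mem_insert_of_mem hi))).congr_deriv ?_
    ring

/-- The direction `Pi.single i 1` selects the pairs containing `i`; antisymmetry of `w` turns those
with `i` in second position into terms `w i k`. -/
theorem sum_pairs_single (w : Fin n → Fin n → ℂ) (hw : ∀ j k, w k j = -w j k) (i : Fin n) :
    ∑ j, ∑ k ∈ Finset.Ioi j, w j k *
      (((Pi.single i 1 : Fin n → ℝ) j - (Pi.single i 1 : Fin n → ℝ) k : ℝ) : ℂ) =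
    ∑ k ∈ Finset.univ.erase i, w i k := by
  have h1 : ∑ j, ∑ k ∈ Finset.Ioi j, w j k * (((Pi.single i 1 : Fin n → ℝ) j : ℝ) : ℂ) =
      ∑ k ∈ Finset.Ioi i, w i k := by
    rw [Finset.sum_eq_single i]
    · simp
    · intro j _ hj
      simp [hj]
    · simp
  have h2 : ∑ j, ∑ k ∈ Finset.Ioi j, w j k * (((Pi.single i 1 : Fin n → ℝ) k : ℝ) : ℂ) =
      -∑ j ∈ Finset.Iio i, w i j := by
    rw [Finset.sum_comm' (t' := Finset.univ) (s' := fun k => Finset.Iio k) (by simp),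
      Finset.sum_eq_single i, ← Finset.sum_neg_distrib]
    · exact Finset.sum_congr rfl fun j _ => by simp [hw i j]
    · intro j _ hj
      simp [hj]
    · simp
  have h3 : Finset.univ.erase i = Finset.Ioi i ∪ Finset.Iio i := by
    ext k
    simp only [Finset.mem_erase, Finset.mem_univ, and_true, Finset.mem_union, Finset.mem_Ioi,
      Finset.mem_Iio]
    exact ⟨fun h => (lt_or_gt_of_ne h).symm, fun h => h.elim ne_of_gt ne_of_lt⟩
  have h4 : Disjoint (Finset.Ioi i) (Finset.Iio i) := by
    rw [Finset.disjoint_left]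
    intro k hk hk'
    exact lt_asymm (Finset.mem_Ioi.1 hk) (Finset.mem_Iio.1 hk')
  simp only [Complex.ofReal_sub, mul_sub, Finset.sum_sub_distrib]
  rw [h1, h2, h3, Finset.sum_union h4, sub_neg_eq_add]

/-- Stated for abstract one-variable factors so that it covers both the density (complex powers of
absolute values) and the arrangement polynomial (linear factors, all exponents 1). -/
theorem hasLineDerivAt_of_logDer {c₁ c₂ c₃ κ : ℂ} {f₁ f₂ f₃ h : ℝ → ℂ}
    (h₁ : ∀ t, t ≠ P.x₁ → HasDerivAt f₁ (f₁ t * (c₁ / ((t - P.x₁ : ℝ) : ℂ))) t)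
    (h₂ : ∀ t, t ≠ P.x₂ → HasDerivAt f₂ (f₂ t * (c₂ / ((t - P.x₂ : ℝ) : ℂ))) t)
    (h₃ : ∀ t, t ≠ P.x₃ → HasDerivAt f₃ (f₃ t * (c₃ / ((t - P.x₃ : ℝ) : ℂ))) t)
    (hh : ∀ t, t ≠ 0 → HasDerivAt h (h t * (κ / (t : ℂ))) t)
    (i : Fin n) {z : Fin n → ℝ} (hz : P.arrangement z ≠ 0) :
    HasLineDerivAt ℝ (fun z : Fin n → ℝ => (∏ i, f₁ (z i) * f₂ (z i) * f₃ (z i)) *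
        ∏ j, ∏ k ∈ Finset.Ioi j, h (z j - z k))
      (((∏ i, f₁ (z i) * f₂ (z i) * f₃ (z i)) * ∏ j, ∏ k ∈ Finset.Ioi j, h (z j - z k)) *
        P.logDer c₁ c₂ c₃ κ i z) z (Pi.single i 1) := by
  rw [P.arrangement_ne_zero_iff] at hz
  set e : Fin n → ℝ := Pi.single i 1 with he
  have hline : ∀ j, HasDerivAt (fun t : ℝ => (z + t • e) j) (e j) 0 := fun j => by
    simpa using ((hasDerivAt_id (0 : ℝ)).mul_const (e j)).const_add (z j)
  have comp : ∀ (f : ℝ → ℂ) (l : ℂ) (y : ℝ → ℝ) (y' : ℝ), HasDerivAt f (f (y 0) * l) (y 0) →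
      HasDerivAt y y' 0 → HasDerivAt (fun t => f (y t)) (f (y 0) * (l * (y' : ℂ))) 0 := by
    intro f l y y' hf hy
    refine (hf.scomp (0 : ℝ) hy).congr_deriv ?_
    simp only [Complex.real_smul]
    ring
  have hs : HasDerivAt (fun t : ℝ => ∏ j, f₁ ((z + t • e) j) * f₂ ((z + t • e) j) *
      f₃ ((z + t • e) j)) ((∏ j, f₁ ((z + (0 : ℝ) • e) j) * f₂ ((z + (0 : ℝ) • e) j) *
      f₃ ((z + (0 : ℝ) • e) j)) * ∑ j, (c₁ / ((z j - P.x₁ : ℝ) : ℂ) +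
        c₂ / ((z j - P.x₂ : ℝ) : ℂ) + c₃ / ((z j - P.x₃ : ℝ) : ℂ)) * ((e j : ℝ) : ℂ)) 0 := by
    refine hasDerivAt_prod_of_logDeriv _ (f := fun j t => f₁ ((z + t • e) j) *
      f₂ ((z + t • e) j) * f₃ ((z + t • e) j)) fun j _ => ?_
    have a1 := comp f₁ _ (fun t => (z + t • e) j) (e j)
      (by simpa using h₁ (z j) (hz.1 j).1) (hline j)
    have a2 := comp f₂ _ (fun t => (z + t • e) j) (e j)
      (by simpa using h₂ (z j) (hz.1 j).2.1) (hline j)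
    have a3 := comp f₃ _ (fun t => (z + t • e) j) (e j)
      (by simpa using h₃ (z j) (hz.1 j).2.2) (hline j)
    refine ((a1.fun_mul a2).fun_mul a3).congr_deriv ?_
    push_cast
    ring
  have hp : HasDerivAt (fun t : ℝ => ∏ j, ∏ k ∈ Finset.Ioi j, h ((z + t • e) j - (z + t • e) k))
      ((∏ j, ∏ k ∈ Finset.Ioi j, h ((z + (0 : ℝ) • e) j - (z + (0 : ℝ) • e) k)) *
        ∑ j, ∑ k ∈ Finset.Ioi j, κ / ((z j - z k : ℝ) : ℂ) * ((e j - e k : ℝ) : ℂ)) 0 := by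
    refine hasDerivAt_prod_of_logDeriv _
      (f := fun j t => ∏ k ∈ Finset.Ioi j, h ((z + t • e) j - (z + t • e) k)) fun j _ =>
      hasDerivAt_prod_of_logDeriv _ (f := fun k t => h ((z + t • e) j - (z + t • e) k))
      fun k hk => ?_
    exact comp h _ (fun t => (z + t • e) j - (z + t • e) k) (e j - e k)
      (by simpa using hh (z j - z k) (sub_ne_zero.2 (hz.2 j k (Finset.mem_Ioi.1 hk).ne)))
      ((hline j).fun_sub (hline k))
  refine (hs.fun_mul hp).congr_deriv ?_
  rw [sum_pairs_single (fun j k => κ / ((z j - z k : ℝ) : ℂ))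
    (fun j k => by rw [← neg_sub (z j), Complex.ofReal_neg, div_neg])]
  have hse : ∑ j, (c₁ / ((z j - P.x₁ : ℝ) : ℂ) + c₂ / ((z j - P.x₂ : ℝ) : ℂ) +
      c₃ / ((z j - P.x₃ : ℝ) : ℂ)) * ((e j : ℝ) : ℂ) = c₁ / ((z i - P.x₁ : ℝ) : ℂ) +
      c₂ / ((z i - P.x₂ : ℝ) : ℂ) + c₃ / ((z i - P.x₃ : ℝ) : ℂ) := by
    rw [Finset.sum_eq_single i]
    · simp [he]
    · intro j _ hj
      simp [he, hj]
    · simp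
  rw [hse]
  simp only [zero_smul, add_zero, logDer]
  ring

theorem hasDerivAt_abs_cpow (a : ℂ) {t : ℝ} (ht : t ≠ 0) :
    HasDerivAt (fun y : ℝ => ((|y| : ℝ) : ℂ) ^ a) (((|t| : ℝ) : ℂ) ^ a * (a / (t : ℂ))) t := by
  have key : ∀ y : ℝ, 0 < y → HasDerivAt (fun y : ℝ => ((y : ℝ) : ℂ) ^ a)
      ((y : ℂ) ^ a * (a / (y : ℂ))) y := by
    intro y hy
    have hy' : (y : ℂ) ≠ 0 := Complex.ofReal_ne_zero.2 hy.ne'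
    have h1 : HasDerivAt (fun x : ℂ => x ^ a) (a * (y : ℂ) ^ (a - 1)) (y : ℂ) := by
      simpa using (hasDerivAt_id (y : ℂ)).cpow_const (c := a) (Or.inl (by simpa using hy))
    refine h1.comp_ofReal.congr_deriv ?_
    rw [Complex.cpow_sub _ _ hy', Complex.cpow_one]
    ring
  rcases lt_or_gt_of_ne ht with h | h
  · have h1 := (key (-t) (neg_pos.2 h)).scomp t (hasDerivAt_neg t)
    rw [abs_of_neg h]
    refine (h1.congr_of_eventuallyEq ?_).congr_deriv ?_
    · filter_upwards [gt_mem_nhds h] with y hy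
      simp [abs_of_neg hy]
    · simp only [Complex.ofReal_neg, div_neg, neg_smul, one_smul]
      ring
  · rw [abs_of_pos h]
    refine (key t h).congr_of_eventuallyEq ?_
    filter_upwards [lt_mem_nhds h] with y hy
    rw [abs_of_pos hy]

theorem hasLineDerivAt_density (i : Fin n) {z : Fin n → ℝ} (hz : P.arrangement z ≠ 0) :
    HasLineDerivAt ℝ P.density
      (P.density z * P.logDer (P.α₁ - 1) (P.α₂ - 1) (P.α₃ - 1) (2 * P.τ) i z) z (Pi.single i 1) := by
  have h1 : ∀ (x : ℝ) (a : ℂ) (t : ℝ), t ≠ x → HasDerivAt (fun t : ℝ => ((|x - t| : ℝ) : ℂ) ^ a)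
      (((|x - t| : ℝ) : ℂ) ^ a * (a / ((t - x : ℝ) : ℂ))) t := by
    intro x a t ht
    have h := (hasDerivAt_abs_cpow a (sub_ne_zero.2 ht)).scomp t ((hasDerivAt_id t).sub_const x)
    simp only [id, one_smul] at h
    rw [abs_sub_comm]
    refine h.congr_of_eventuallyEq (Filter.Eventually.of_forall fun y => ?_)
    simp [abs_sub_comm x y]
  have h := P.hasLineDerivAt_of_logDer (h1 P.x₁ (P.α₁ - 1)) (h1 P.x₂ (P.α₂ - 1))
    (h1 P.x₃ (P.α₃ - 1)) (fun t ht => hasDerivAt_abs_cpow (2 * P.τ) ht) i hz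
  have hd : P.density = fun z : Fin n → ℝ => (∏ i, ((|P.x₁ - z i| : ℝ) : ℂ) ^ (P.α₁ - 1) *
      ((|P.x₂ - z i| : ℝ) : ℂ) ^ (P.α₂ - 1) * ((|P.x₃ - z i| : ℝ) : ℂ) ^ (P.α₃ - 1)) *
      ∏ j, ∏ k ∈ Finset.Ioi j, ((|z j - z k| : ℝ) : ℂ) ^ (2 * P.τ : ℂ) := by
    funext z
    simp only [density, Complex.ofReal_prod, Complex.ofReal_cpow (abs_nonneg _),
      Complex.ofReal_mul, Complex.ofReal_ofNat]
  rw [hd]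
  exact h

theorem hasLineDerivAt_arrangement (i : Fin n) {z : Fin n → ℝ} (hz : P.arrangement z ≠ 0) :
    HasLineDerivAt ℝ (fun z => (P.arrangement z : ℂ))
      (P.arrangement z * P.logDer 1 1 1 1 i z) z (Pi.single i 1) := by
  have h1 : ∀ (x : ℝ) (t : ℝ), t ≠ x → HasDerivAt (fun t : ℝ => ((x - t : ℝ) : ℂ))
      (((x - t : ℝ) : ℂ) * (1 / ((t - x : ℝ) : ℂ))) t := by
    intro x t ht
    have hx : ((t - x : ℝ) : ℂ) ≠ 0 := Complex.ofReal_ne_zero.2 (sub_ne_zero.2 ht)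
    refine ((hasDerivAt_id t).const_sub x).ofReal_comp.congr_deriv ?_
    rw [← neg_sub t x, Complex.ofReal_neg]
    field_simp
    simp
  have h2 : ∀ t : ℝ, t ≠ 0 → HasDerivAt (fun t : ℝ => (t : ℂ)) ((t : ℂ) * (1 / (t : ℂ))) t := by
    intro t ht
    have hx : (t : ℂ) ≠ 0 := Complex.ofReal_ne_zero.2 ht
    refine (hasDerivAt_id t).ofReal_comp.congr_deriv ?_
    field_simp
    simp
  have h := P.hasLineDerivAt_of_logDer (h1 P.x₁) (h1 P.x₂) (h1 P.x₃) h2 i hz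
  simpa only [arrangement, Complex.ofReal_mul, Complex.ofReal_prod] using h

end SelbergParams

/-! ### The tangent field and its divergence -/

namespace SelbergParams

variable (P : SelbergParams) {n : ℕ}

/-- The contribution of a spectator factor to the coefficient of the `bc` term. -/
def weightBC : Factor → ℂ
  | .bc | .b | .c => 1
  | .ab | .ac => 0

/-- The contribution of a spectator factor to the coefficient of the `ac` term. -/
def weightAC : Factor → ℂ
  | .ac | .c => 1
  | .ab | .bc | .b => 0

/-- The contribution of a spectator factor to the coefficient of the `ab` term. -/
def weightAB : Factor → ℂ
  | .ab | .b => 1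
  | .ac | .bc | .c => 0

/-- The `i₀`-th slot carries `(z - x₁)(x₂ - z)(x₃ - z)`, the other slots the factors `w l`; the
coordinates are distributed to the slots by `σ`. -/
def tangentField (w : Fin n → Factor) (i₀ : Fin n) (σ : Equiv.Perm (Fin n)) (z : Fin n → ℝ) : ℂ :=
  P.linA (z (σ i₀)) * P.linB (z (σ i₀)) * P.linC (z (σ i₀)) *
    ∏ l ∈ Finset.univ.erase i₀, P.val (w l) (z (σ l))

/-- The derivative of `tangentField` in the coordinate of the slot `i₀`. -/
def tangentFieldDeriv (w : Fin n → Factor) (i₀ : Fin n) (σ : Equiv.Perm (Fin n))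
    (z : Fin n → ℝ) : ℂ :=
  (P.val .bc (z (σ i₀)) - P.val .ac (z (σ i₀)) - P.val .ab (z (σ i₀))) *
    ∏ l ∈ Finset.univ.erase i₀, P.val (w l) (z (σ l))

theorem prod_val_update (w : Fin n → Factor) (i₀ : Fin n) (f : Factor) (y : Fin n → ℝ) :
    ∏ l, P.val (Function.update w i₀ f l) (y l) =
      P.val f (y i₀) * ∏ l ∈ Finset.univ.erase i₀, P.val (w l) (y l) := by
  rw [← Finset.mul_prod_erase _ _ (Finset.mem_univ i₀), Function.update_self]
  congr 1
  exact Finset.prod_congr rfl fun l hl => by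
    rw [Function.update_of_ne (Finset.ne_of_mem_erase hl)]

/-- Exchanging the coordinates u, v of the slots `i₀` and `k` reverses the sign of the denominator,
so two paired terms add up to the divided difference (F(u)h(v) - F(v)h(u))/(u - v), with F = abc and
h the spectator in slot `k`. This is a polynomial, and a combination of the three products obtained
by putting `bc`, `ac` or `ab` in slot `i₀`. The factor 1/2 is there because each pair is counted
twice. -/
theorem sum_tangentField_div {w : Fin n → Factor} {i₀ k : Fin n} (hk : k ≠ i₀) {z : Fin n → ℝ}
    (hz : P.arrangement z ≠ 0) :
    ∑ σ, P.tangentField w i₀ σ z * (1 / ((z (σ i₀) - z (σ k) : ℝ) : ℂ)) =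
      1 / 2 * (weightBC (w k) * P.symProd (Function.update w i₀ .bc) z -
        weightAC (w k) * P.symProd (Function.update w i₀ .ac) z -
        weightAB (w k) * P.symProd (Function.update w i₀ .ab) z) := by
  set S : Equiv.Perm (Fin n) → ℂ := fun σ =>
    P.tangentField w i₀ σ z * (1 / ((z (σ i₀) - z (σ k) : ℝ) : ℂ)) with hS
  set M : Factor → Equiv.Perm (Fin n) → ℂ := fun f σ =>
    ∏ l, P.val (Function.update w i₀ f l) (z (σ l)) with hM
  have hswap : ∀ F : Equiv.Perm (Fin n) → ℂ,
      ∑ σ, F (σ * Equiv.swap i₀ k) = ∑ σ, F σ := fun F =>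
    Equiv.sum_comp (Equiv.mulRight (Equiv.swap i₀ k)) F
  have hpair : ∀ σ, S σ + S (σ * Equiv.swap i₀ k) = weightBC (w k) * M .bc σ -
      weightAC (w k) * M .ac (σ * Equiv.swap i₀ k) -
      weightAB (w k) * M .ab (σ * Equiv.swap i₀ k) := by
    intro σ
    set R := ∏ l ∈ (Finset.univ.erase i₀).erase k, P.val (w l) (z (σ l)) with hR
    have hkm : k ∈ Finset.univ.erase i₀ := Finset.mem_erase.2 ⟨hk, Finset.mem_univ k⟩
    have hR' : ∏ l ∈ (Finset.univ.erase i₀).erase k,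
        P.val (w l) (z ((σ * Equiv.swap i₀ k) l)) = R :=
      Finset.prod_congr rfl fun l hl => by
        rw [Equiv.Perm.mul_apply, Equiv.swap_apply_of_ne_of_ne
          (Finset.ne_of_mem_erase (Finset.mem_of_mem_erase hl)) (Finset.ne_of_mem_erase hl)]
    have huv : z (σ i₀) - z (σ k) ≠ 0 := sub_ne_zero.2
      ((P.arrangement_ne_zero_iff.1 hz).2 _ _ fun h => hk (σ.injective h).symm)
    have huv' : (z (σ i₀) : ℂ) - z (σ k) ≠ 0 := by exact_mod_cast huv
    have hvu' : (z (σ k) : ℂ) - z (σ i₀) ≠ 0 := by rw [← neg_sub]; exact neg_ne_zero.2 huv'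
    have hinv : ((z (σ k) : ℂ) - z (σ i₀))⁻¹ = -((z (σ i₀) : ℂ) - z (σ k))⁻¹ := by
      rw [← neg_sub, inv_neg]
    simp only [hS, hM, tangentField, P.prod_val_update w i₀ _ (fun l => z (σ l)),
      P.prod_val_update w i₀ _ (fun l => z ((σ * Equiv.swap i₀ k) l)),
      ← Finset.mul_prod_erase _ _ hkm, hR', ← hR]
    simp only [Equiv.Perm.mul_apply, Equiv.swap_apply_left, Equiv.swap_apply_right,
      Complex.ofReal_sub, one_div, hinv]
    generalize hd : ((z (σ i₀) : ℂ) - z (σ k))⁻¹ = d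
    have hd' : ((z (σ i₀) : ℂ) - z (σ k)) * d = 1 := by rw [← hd, mul_inv_cancel₀ huv']
    -- For h = ab or ac, the common factor h(u)h(v) leaves the difference quotient of c or b, which
    -- is -1; for h = bc that of a, which is 1; for h = b or c, that of the quadratic ac or ab.
    cases w k <;>
      simp only [weightBC, weightAC, weightAB, val, linA, linB, linC, Complex.ofReal_sub] <;>
      generalize (z (σ i₀) : ℂ) = u at * <;> generalize (z (σ k) : ℂ) = v at *
    · linear_combination (-(u - P.x₁) * (P.x₂ - u) * (v - P.x₁) * (P.x₂ - v) * R) * hd'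
    · linear_combination (-(u - P.x₁) * (P.x₃ - u) * (v - P.x₁) * (P.x₃ - v) * R) * hd'
    · linear_combination ((P.x₂ - u) * (P.x₃ - u) * (P.x₂ - v) * (P.x₃ - v) * R) * hd'
    · linear_combination ((P.x₂ - u) * (P.x₂ - v) * ((P.x₃ - u) - (v - P.x₁)) * R) * hd'
    · linear_combination ((P.x₃ - u) * (P.x₃ - v) * ((P.x₂ - u) - (v - P.x₁)) * R) * hd'
  have h2 : 2 * ∑ σ, S σ = ∑ σ, (S σ + S (σ * Equiv.swap i₀ k)) := by
    rw [Finset.sum_add_distrib, hswap S]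
    ring
  simp only [hpair, Finset.sum_sub_distrib, ← Finset.mul_sum] at h2
  rw [hswap (M .ac), hswap (M .ab)] at h2
  change ∑ σ, S σ = 1 / 2 * (weightBC (w k) * ∑ σ, M .bc σ - weightAC (w k) * ∑ σ, M .ac σ -
    weightAB (w k) * ∑ σ, M .ab σ)
  linear_combination (1 / 2) * h2

/-- The exponents are kept free because the identity is used twice: for the density it yields the
divergence, for the arrangement polynomial the tangency. The poles at the `xₘ` cancel against abc
already for each permutation. -/
theorem sum_tangentField_mul_logDer (w : Fin n → Factor) (i₀ : Fin n) (c₁ c₂ c₃ κ : ℂ)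
    {z : Fin n → ℝ} (hz : P.arrangement z ≠ 0) :
    ∑ σ : Equiv.Perm (Fin n), P.tangentField w i₀ σ z * P.logDer c₁ c₂ c₃ κ (σ i₀) z =
      (c₁ + κ / 2 * ∑ k ∈ Finset.univ.erase i₀, weightBC (w k)) *
        P.symProd (Function.update w i₀ .bc) z -
      (c₂ + κ / 2 * ∑ k ∈ Finset.univ.erase i₀, weightAC (w k)) *
        P.symProd (Function.update w i₀ .ac) z -
      (c₃ + κ / 2 * ∑ k ∈ Finset.univ.erase i₀, weightAB (w k)) *
        P.symProd (Function.update w i₀ .ab) z := by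
  have hreindex : ∀ σ : Equiv.Perm (Fin n),
      ∑ k ∈ Finset.univ.erase (σ i₀), κ / ((z (σ i₀) - z k : ℝ) : ℂ) =
      ∑ k ∈ Finset.univ.erase i₀, κ * (1 / ((z (σ i₀) - z (σ k) : ℝ) : ℂ)) := by
    intro σ
    refine (Finset.sum_equiv σ (fun k => ?_) fun k _ => ?_).symm
    · simp
    · rw [mul_one_div]
  have hsingle : ∀ σ : Equiv.Perm (Fin n), P.tangentField w i₀ σ z *
      (c₁ / ((z (σ i₀) - P.x₁ : ℝ) : ℂ) + c₂ / ((z (σ i₀) - P.x₂ : ℝ) : ℂ) +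
        c₃ / ((z (σ i₀) - P.x₃ : ℝ) : ℂ)) =
      c₁ * ∏ l, P.val (Function.update w i₀ .bc l) (z (σ l)) -
      c₂ * ∏ l, P.val (Function.update w i₀ .ac l) (z (σ l)) -
      c₃ * ∏ l, P.val (Function.update w i₀ .ab l) (z (σ l)) := by
    intro σ
    obtain ⟨h1, h2, h3⟩ := (P.arrangement_ne_zero_iff.1 hz).1 (σ i₀)
    have h1' : ((z (σ i₀) : ℂ) - P.x₁) ≠ 0 := by exact_mod_cast sub_ne_zero.2 h1
    have h2' : ((z (σ i₀) : ℂ) - P.x₂) ≠ 0 := by exact_mod_cast sub_ne_zero.2 h2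
    have h3' : ((z (σ i₀) : ℂ) - P.x₃) ≠ 0 := by exact_mod_cast sub_ne_zero.2 h3
    simp only [P.prod_val_update w i₀ _ (fun l => z (σ l)), tangentField]
    generalize ∏ l ∈ Finset.univ.erase i₀, P.val (w l) (z (σ l)) = R
    simp only [val, linA, linB, linC, Complex.ofReal_sub]
    field_simp
    ring
  have hterm : ∀ σ : Equiv.Perm (Fin n), P.tangentField w i₀ σ z * P.logDer c₁ c₂ c₃ κ (σ i₀) z =
      (c₁ * ∏ l, P.val (Function.update w i₀ .bc l) (z (σ l)) -
      c₂ * ∏ l, P.val (Function.update w i₀ .ac l) (z (σ l)) -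
      c₃ * ∏ l, P.val (Function.update w i₀ .ab l) (z (σ l))) +
      ∑ k ∈ Finset.univ.erase i₀,
        κ * (P.tangentField w i₀ σ z * (1 / ((z (σ i₀) - z (σ k) : ℝ) : ℂ))) := by
    intro σ
    rw [logDer, mul_add, hsingle, hreindex, Finset.mul_sum]
    congr 1
    exact Finset.sum_congr rfl fun k _ => by ring
  rw [Finset.sum_congr rfl fun σ _ => hterm σ, Finset.sum_add_distrib, Finset.sum_comm]
  have hpairs : ∑ k ∈ Finset.univ.erase i₀, ∑ σ : Equiv.Perm (Fin n),
      κ * (P.tangentField w i₀ σ z * (1 / ((z (σ i₀) - z (σ k) : ℝ) : ℂ))) =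
      ∑ k ∈ Finset.univ.erase i₀, κ * (1 / 2 *
        (weightBC (w k) * P.symProd (Function.update w i₀ .bc) z -
        weightAC (w k) * P.symProd (Function.update w i₀ .ac) z -
        weightAB (w k) * P.symProd (Function.update w i₀ .ab) z)) :=
    Finset.sum_congr rfl fun k hk => by
      rw [← Finset.mul_sum, P.sum_tangentField_div (Finset.ne_of_mem_erase hk) hz]
  rw [hpairs, ← Finset.mul_sum, ← Finset.mul_sum]
  simp only [Finset.sum_sub_distrib, ← Finset.mul_sum, ← Finset.sum_mul]
  simp only [symProd]
  ring

theorem sum_tangentFieldDeriv (w : Fin n → Factor) (i₀ : Fin n) (z : Fin n → ℝ) :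
    ∑ σ : Equiv.Perm (Fin n), P.tangentFieldDeriv w i₀ σ z =
      P.symProd (Function.update w i₀ .bc) z - P.symProd (Function.update w i₀ .ac) z -
        P.symProd (Function.update w i₀ .ab) z := by
  simp only [symProd, ← Finset.sum_sub_distrib]
  refine Finset.sum_congr rfl fun σ _ => ?_
  simp only [P.prod_val_update w i₀ _ (fun l => z (σ l)), tangentFieldDeriv]
  ring

theorem continuous_val (f : Factor) : Continuous (P.val f) := by
  have ha : Continuous P.linA := by unfold linA; fun_prop
  have hb : Continuous P.linB := by unfold linB; fun_prop
  have hc : Continuous P.linC := by unfold linC; fun_prop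
  cases f
  exacts [ha.mul hb, ha.mul hc, hb.mul hc, hb, hc]

theorem continuous_symProd (w : Fin n → Factor) : Continuous (P.symProd w) :=
  continuous_finsetSum _ fun σ _ => continuous_finsetProd _ fun l _ =>
    (P.continuous_val (w l)).comp (continuous_apply (σ l))

theorem hasLineDerivAt_tangentField (w : Fin n → Factor) (i₀ : Fin n) (σ : Equiv.Perm (Fin n))
    (z : Fin n → ℝ) :
    HasLineDerivAt ℝ (P.tangentField w i₀ σ) (P.tangentFieldDeriv w i₀ σ z) z
      (Pi.single (σ i₀) 1) := by
  have hf : (fun t : ℝ => P.tangentField w i₀ σ (z + t • Pi.single (σ i₀) 1)) = fun t : ℝ =>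
      (((z (σ i₀) : ℂ) + t) - P.x₁) * (P.x₂ - ((z (σ i₀) : ℂ) + t)) *
        (P.x₃ - ((z (σ i₀) : ℂ) + t)) *
        ∏ l ∈ Finset.univ.erase i₀, P.val (w l) (z (σ l)) := by
    funext t
    have hprod : ∏ l ∈ Finset.univ.erase i₀,
        P.val (w l) ((z + t • (Pi.single (σ i₀) 1 : Fin n → ℝ)) (σ l)) =
        ∏ l ∈ Finset.univ.erase i₀, P.val (w l) (z (σ l)) :=
      Finset.prod_congr rfl fun l hl => by
        have : σ l ≠ σ i₀ := fun h => Finset.ne_of_mem_erase hl (σ.injective h)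
        simp [this]
    rw [tangentField, hprod]
    simp [linA, linB, linC]
  rw [HasLineDerivAt, hf]
  have hu : HasDerivAt (fun t : ℝ => (z (σ i₀) : ℂ) + t) 1 0 := by
    simpa using (hasDerivAt_id (0 : ℝ)).ofReal_comp.const_add (z (σ i₀) : ℂ)
  refine ((((hu.sub_const (P.x₁ : ℂ)).fun_mul (hu.const_sub (P.x₂ : ℂ))).fun_mul
    (hu.const_sub (P.x₃ : ℂ))).mul_const _).congr_deriv ?_
  simp only [tangentFieldDeriv, val, linA, linB, linC]
  push_cast
  ring

/-- A bounded open set whose boundary lies in the arrangement and on which the density is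
integrable. -/
structure IsAdmissible (U : Set (Fin n → ℝ)) : Prop where
  isOpen : IsOpen U
  isBounded : Bornology.IsBounded U
  frontier_subset : ∀ z ∈ frontier U, P.arrangement z = 0
  integrableOn : IntegrableOn P.density U

variable {P}

theorem IsAdmissible.integrableOn_mul {U : Set (Fin n → ℝ)} (hU : P.IsAdmissible U)
    {f : (Fin n → ℝ) → ℂ} (hf : Continuous f) : IntegrableOn (fun z => f z * P.density z) U :=
  IntegrableOn.continuous_mul_of_isBounded hU.isOpen.measurableSet hU.isBounded hf hU.integrableOn

theorem average_const_mul (U : Set (Fin n → ℝ)) (a : ℂ) (f : (Fin n → ℝ) → ℂ) :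
    P.average U (fun z => a * f z) = a * P.average U f := by
  simp only [average, mul_assoc, integral_const_mul]

theorem IsAdmissible.average_sub {U : Set (Fin n → ℝ)} (hU : P.IsAdmissible U)
    {f g : (Fin n → ℝ) → ℂ} (hf : Continuous f) (hg : Continuous g) :
    P.average U (fun z => f z - g z) = P.average U f - P.average U g := by
  simp only [average, sub_mul]
  exact integral_sub (hU.integrableOn_mul hf) (hU.integrableOn_mul hg)

theorem IsAdmissible.average_sub_sub {U : Set (Fin n → ℝ)} (hU : P.IsAdmissible U) {ι : Type*}
    {f : ι → (Fin n → ℝ) → ℂ} (hf : ∀ i, Continuous (f i)) (a b c : ℂ) (i j k : ι) :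
    P.average U (fun z => a * f i z - b * f j z - c * f k z) =
      a * P.average U (f i) - b * P.average U (f j) - c * P.average U (f k) := by
  have h : ∀ (x : ℂ) (l : ι), Continuous fun z => x * f l z := fun x l =>
    continuous_const.mul (hf l)
  rw [hU.average_sub (f := fun z => a * f i z - b * f j z) ((h a i).sub (h b j)) (h c k),
    hU.average_sub (h a i) (h b j)]
  simp only [average_const_mul]

/-- The integral of the divergence vanishes. The derivative of abc, which is bc - ac - ab, raises
each exponent `αₘ - 1` to `αₘ`, and `κ = 2τ` turns `κ / 2` into `τ`. -/
theorem IsAdmissible.average_symProd_relation {U : Set (Fin n → ℝ)} (hU : P.IsAdmissible U)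
    (w : Fin n → Factor) (i₀ : Fin n) :
    (P.α₁ + P.τ * ∑ k ∈ Finset.univ.erase i₀, weightBC (w k)) *
        P.average U (P.symProd (Function.update w i₀ .bc)) =
      (P.α₂ + P.τ * ∑ k ∈ Finset.univ.erase i₀, weightAC (w k)) *
        P.average U (P.symProd (Function.update w i₀ .ac)) +
      (P.α₃ + P.τ * ∑ k ∈ Finset.univ.erase i₀, weightAB (w k)) *
        P.average U (P.symProd (Function.update w i₀ .ab)) := by
  set E : ℂ → ℂ → ℂ → ℂ → (Fin n → ℝ) → ℂ := fun c₁ c₂ c₃ κ z =>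
    (c₁ + κ / 2 * ∑ k ∈ Finset.univ.erase i₀, weightBC (w k)) *
      P.symProd (Function.update w i₀ .bc) z -
    (c₂ + κ / 2 * ∑ k ∈ Finset.univ.erase i₀, weightAC (w k)) *
      P.symProd (Function.update w i₀ .ac) z -
    (c₃ + κ / 2 * ∑ k ∈ Finset.univ.erase i₀, weightAB (w k)) *
      P.symProd (Function.update w i₀ .ab) z with hE
  have hs := fun f : Factor => P.continuous_symProd (Function.update w i₀ f)
  have hEc : ∀ c₁ c₂ c₃ κ, Continuous (E c₁ c₂ c₃ κ) := fun c₁ c₂ c₃ κ =>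
    ((continuous_const.mul (hs .bc)).sub (continuous_const.mul (hs .ac))).sub
      (continuous_const.mul (hs .ab))
  have hrest : ∀ σ : Equiv.Perm (Fin n), Continuous fun z : Fin n → ℝ =>
      ∏ l ∈ Finset.univ.erase i₀, P.val (w l) (z (σ l)) := fun σ =>
    continuous_finsetProd _ fun l _ => (P.continuous_val (w l)).comp (continuous_apply (σ l))
  have hv := fun (f : Factor) (σ : Equiv.Perm (Fin n)) =>
    (P.continuous_val f).comp (continuous_apply (A := fun _ : Fin n => ℝ) (σ i₀))
  have key := setIntegral_divergence_eq_zero (μ := (volume : Measure (Fin n → ℝ))) hU.isOpen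
    hU.isBounded P.continuous_arrangement P.ae_arrangement_ne_zero hU.frontier_subset
    hU.integrableOn
    (v := fun σ : Equiv.Perm (Fin n) => Pi.single (σ i₀) 1)
    (g := P.tangentField w i₀) (dg := P.tangentFieldDeriv w i₀)
    (ℓ := fun σ => P.logDer (P.α₁ - 1) (P.α₂ - 1) (P.α₃ - 1) (2 * P.τ) (σ i₀))
    (m := fun σ => P.logDer 1 1 1 1 (σ i₀))
    (D := E P.α₁ P.α₂ P.α₃ (2 * P.τ)) (K := E 1 1 1 1)
    (fun σ z hz => P.hasLineDerivAt_arrangement (σ i₀) hz)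
    (fun σ => P.continuousOn_logDer _ _ _ _ (σ i₀))
    (fun σ z hz => P.hasLineDerivAt_density (σ i₀) hz)
    (fun σ => P.continuousOn_logDer _ _ _ _ (σ i₀))
    (fun σ z => P.hasLineDerivAt_tangentField w i₀ σ z)
    (fun σ => ((hv .ab σ).mul (hv .c σ)).mul (hrest σ))
    (fun σ => (((hv .bc σ).sub (hv .ac σ)).sub (hv .ab σ)).mul (hrest σ))
    (hEc _ _ _ _) (hEc _ _ _ _)
    (fun z hz => by
      rw [Finset.sum_add_distrib, P.sum_tangentField_mul_logDer w i₀ _ _ _ _ hz,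
        P.sum_tangentFieldDeriv]
      simp only [hE]
      ring)
    (fun z hz => P.sum_tangentField_mul_logDer w i₀ _ _ _ _ hz)
  have key' := (hU.average_sub_sub P.continuous_symProd _ _ _ _ _ _).symm.trans key
  linear_combination key'

end SelbergParams

/-! ### Averages indexed by multisets of factors -/

theorem exists_perm_comp_eq_of_map_univ_eq {ι α : Type*} [Fintype ι] [DecidableEq α] {w w' : ι → α}
    (h : Finset.univ.val.map w = Finset.univ.val.map w') :
    ∃ e : Equiv.Perm ι, ∀ i, w' (e i) = w i := by
  have hcard : ∀ a, Fintype.card {i // w i = a} = Fintype.card {i // w' i = a} := by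
    intro a
    have := congrArg (Multiset.count a) h
    simp only [Multiset.count_map, ← Finset.filter_val, Finset.card_val] at this
    rw [Fintype.card_subtype, Fintype.card_subtype]
    simpa only [eq_comm] using this
  exact ⟨Equiv.ofFiberEquiv fun a => Fintype.equivOfCardEq (hcard a),
    fun i => Equiv.ofFiberEquiv_map _ i⟩

/-- Realizes a multiset of n - 1 spectators on `Fin n` with one free slot, so that relations for
words with an updated slot become relations for multisets `x ::ₘ S`. -/
theorem exists_fin_map_update {α : Type*} {n : ℕ} (S : Multiset α) (hS : S.card + 1 = n) (a : α) :
    ∃ (w : Fin n → α) (i₀ : Fin n), (Finset.univ.erase i₀).val.map w = S ∧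
      ∀ x, Finset.univ.val.map (Function.update w i₀ x) = x ::ₘ S := by
  subst hS
  induction S using Quotient.inductionOn with
  | h L =>
    have hL : (L : Multiset α).card = L.length := Multiset.coe_card L
    let w : Fin ((L : Multiset α).card + 1) → α := Fin.cons a fun i => L.get (i.cast hL)
    have hupd : ∀ x, Finset.univ.val.map (Function.update w 0 x) = x ::ₘ (L : Multiset α) := by
      intro x
      have hw : Function.update w 0 x = Fin.cons x fun i => L.get (i.cast hL) :=
        Fin.update_cons_zero _ _ _
      rw [hw, Fin.univ_val_map, List.ofFn_succ]
      simp only [Fin.cons_zero, Fin.cons_succ, ← Multiset.cons_coe]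
      congr 2
      exact List.ext_get (by simp) fun i h1 h2 => by simp
    refine ⟨w, 0, ?_, hupd⟩
    have h1 := hupd a
    have h2 : Function.update w 0 a = w := by
      rw [Function.update_eq_self_iff]
      rfl
    rw [h2, ← Finset.insert_erase (Finset.mem_univ (0 : Fin ((L : Multiset α).card + 1))),
      Finset.insert_val_of_notMem (Finset.notMem_erase _ _), Multiset.map_cons] at h1
    exact (Multiset.cons_inj_right a).1 h1

namespace SelbergParams

variable (P : SelbergParams) {n : ℕ}

theorem symProd_comp_perm (w : Fin n → Factor) (e : Equiv.Perm (Fin n)) :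
    P.symProd (fun l => w (e l)) = P.symProd w := by
  funext z
  rw [symProd, symProd, ← Equiv.sum_comp (Equiv.mulRight e)]
  exact Finset.sum_congr rfl fun σ _ =>
    Equiv.prod_comp e fun l => P.val (w l) (z (σ l))

/-- The average over `U` of the symmetric polynomial determined by a multiset of `n` factors. -/
def bracket (U : Set (Fin n → ℝ)) : Multiset Factor → ℂ :=
  Function.extend (fun w : Fin n → Factor => Finset.univ.val.map w)
    (fun w => P.average U (P.symProd w)) 0

theorem bracket_map (U : Set (Fin n → ℝ)) (w : Fin n → Factor) :
    P.bracket U (Finset.univ.val.map w) = P.average U (P.symProd w) := by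
  -- Words with the same multiset of factors differ by a permutation of the slots, which `symProd`
  -- does not see.
  refine Function.FactorsThrough.extend_apply (fun w₁ w₂ h => ?_) _ w
  obtain ⟨e, he⟩ := exists_perm_comp_eq_of_map_univ_eq h
  have : w₁ = fun l => w₂ (e l) := funext fun l => (he l).symm
  rw [this, symProd_comp_perm]

theorem symProd_update_bc (w : Fin n → Factor) (i₀ : Fin n) :
    P.symProd (Function.update w i₀ .bc) = (fun z =>
      ((P.x₂ - P.x₁ : ℝ) : ℂ) * P.symProd (Function.update w i₀ .c) z -
        1 * P.symProd (Function.update w i₀ .ac) z - 0 * P.symProd (Function.update w i₀ .ac) z) ∧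
    P.symProd (Function.update w i₀ .bc) = (fun z =>
      ((P.x₃ - P.x₁ : ℝ) : ℂ) * P.symProd (Function.update w i₀ .b) z -
        1 * P.symProd (Function.update w i₀ .ab) z - 0 * P.symProd (Function.update w i₀ .ab) z) := by
  constructor <;> funext z <;>
    simp only [symProd, one_mul, zero_mul, sub_zero, Finset.mul_sum, ← Finset.sum_sub_distrib] <;>
    refine Finset.sum_congr rfl fun σ _ => ?_ <;>
    simp only [P.prod_val_update w i₀ _ (fun l => z (σ l))] <;>
    generalize ∏ l ∈ Finset.univ.erase i₀, P.val (w l) (z (σ l)) = R <;>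
    simp only [val, linA, linB, linC] <;> push_cast <;> ring

variable {P}

theorem IsAdmissible.bracket_bc {U : Set (Fin n → ℝ)} (hU : P.IsAdmissible U)
    (S : Multiset Factor) (hS : S.card + 1 = n) :
    P.bracket U (.bc ::ₘ S) =
        ((P.x₂ - P.x₁ : ℝ) : ℂ) * P.bracket U (.c ::ₘ S) - P.bracket U (.ac ::ₘ S) ∧
      P.bracket U (.bc ::ₘ S) =
        ((P.x₃ - P.x₁ : ℝ) : ℂ) * P.bracket U (.b ::ₘ S) - P.bracket U (.ab ::ₘ S) ∧
      (P.α₁ + P.τ * (S.map weightBC).sum) * P.bracket U (.bc ::ₘ S) =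
        (P.α₂ + P.τ * (S.map weightAC).sum) * P.bracket U (.ac ::ₘ S) +
        (P.α₃ + P.τ * (S.map weightAB).sum) * P.bracket U (.ab ::ₘ S) := by
  obtain ⟨w, i₀, hw, hupd⟩ := exists_fin_map_update S hS .b
  obtain ⟨h1, h2⟩ := P.symProd_update_bc w i₀
  have hc := fun f : Factor => P.continuous_symProd (Function.update w i₀ f)
  simp only [← hupd, bracket_map]
  refine ⟨?_, ?_, ?_⟩
  · rw [h1, hU.average_sub_sub hc]
    ring
  · rw [h2, hU.average_sub_sub hc]
    ring
  · rw [← hw, Multiset.map_map, Multiset.map_map, Multiset.map_map]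
    exact hU.average_symProd_relation w i₀

/-- The multiset of `p` factors `ab`, `q` factors `ac`, `s` factors `b` and `t` factors `c`. -/
def block (p q s t : ℕ) : Multiset Factor :=
  Multiset.replicate p .ab + Multiset.replicate q .ac + Multiset.replicate s .b +
    Multiset.replicate t .c

/-- The relations satisfied by the averages of the symmetric polynomials with `p` factors
`(z - x₁)(x₂ - z)`, `q` factors `(z - x₁)(x₃ - z)`, `s` factors `x₂ - z` and `t` factors
`x₃ - z`. -/
structure BlockRelations (n : ℕ) (α₁ α₂ α₃ τ b c : ℂ) (f : ℕ → ℕ → ℕ → ℕ → ℂ) : Prop where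
  linear : ∀ p q s t, p + q + s + t + 1 = n →
    b * f p q s (t + 1) - f p (q + 1) s t = c * f p q (s + 1) t - f (p + 1) q s t
  parts : ∀ p q s t, p + q + s + t + 1 = n →
    (α₁ + (s + t) * τ) * (b * f p q s (t + 1) - f p (q + 1) s t) =
      (α₂ + (q + t) * τ) * f p (q + 1) s t + (α₃ + (p + s) * τ) * f (p + 1) q s t

/-- Both expressions for the `bc` average are equated in `linear`; the first is substituted into the
divergence relation in `parts`. The coefficients s + t, q + t and p + s count the spectators by
weight. -/
theorem IsAdmissible.blockRelations {U : Set (Fin n → ℝ)} (hU : P.IsAdmissible U) :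
    BlockRelations n P.α₁ P.α₂ P.α₃ P.τ ((P.x₂ - P.x₁ : ℝ) : ℂ) ((P.x₃ - P.x₁ : ℝ) : ℂ)
      (fun p q s t => P.bracket U (block p q s t)) := by
  have hab : ∀ p q s t, Factor.ab ::ₘ block p q s t = block (p + 1) q s t := fun p q s t => by
    simp [block, Multiset.replicate_succ]
  have hac : ∀ p q s t, Factor.ac ::ₘ block p q s t = block p (q + 1) s t := fun p q s t => by
    simp [block, Multiset.replicate_succ]
  have hb : ∀ p q s t, Factor.b ::ₘ block p q s t = block p q (s + 1) t := fun p q s t => by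
    simp [block, Multiset.replicate_succ]
  have hc : ∀ p q s t, Factor.c ::ₘ block p q s t = block p q s (t + 1) := fun p q s t => by
    simp [block, Multiset.replicate_succ]
  have key := fun p q s t (h : p + q + s + t + 1 = n) =>
    hU.bracket_bc (block p q s t) (by simpa [block] using h)
  simp only [hab, hac, hb, hc] at key
  refine ⟨fun p q s t h => ?_, fun p q s t h => ?_⟩
  · obtain ⟨h1, h2, -⟩ := key p q s t h
    rw [← h1, ← h2]
  · obtain ⟨h1, -, h3⟩ := key p q s t h
    rw [← h1]
    have hsum : ∀ w : Factor → ℂ, ((block p q s t).map w).sum =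
        p * w .ab + q * w .ac + s * w .b + t * w .c := fun w => by
      simp only [block, Multiset.map_add, Multiset.map_replicate, Multiset.sum_add,
        Multiset.sum_replicate, nsmul_eq_mul]
    simp only [hsum, weightBC, weightAC, weightAB] at h3
    linear_combination h3

end SelbergParams

/-! ### Rising products and lattice path weights -/

theorem stepPoch_zero (x t : ℂ) : stepPoch x t 0 = 1 := by simp [stepPoch]

theorem stepPoch_succ (x t : ℂ) (k : ℕ) :
    stepPoch x t (k + 1) = stepPoch x t k * (x + k * t) := by
  simp [stepPoch, Finset.prod_range_succ]

theorem stepPoch_add (x t : ℂ) (k l : ℕ) :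
    stepPoch x t (k + l) = stepPoch x t k * stepPoch (x + k * t) t l := by
  simp only [stepPoch, Finset.prod_range_add]
  congr 1
  exact Finset.prod_congr rfl fun i _ => by push_cast; ring

theorem stepPoch_succ' (x t : ℂ) (k : ℕ) :
    stepPoch x t (k + 1) = x * stepPoch (x + t) t k := by
  rw [add_comm k 1, stepPoch_add]
  simp [stepPoch]

theorem stepPoch_ne_zero {x t : ℂ} {k : ℕ} (h : ∀ s < k, x + s * t ≠ 0) : stepPoch x t k ≠ 0 :=
  Finset.prod_ne_zero_iff.2 fun s hs => h s (Finset.mem_range.1 hs)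

theorem choose_succ_right_mul (p m : ℕ) (hm : m ≤ p) :
    (p.choose (m + 1) : ℂ) * (m + 1) = p.choose m * (p - m) := by
  have := Nat.choose_succ_right_eq p m
  have h2 : ((p - m : ℕ) : ℂ) = p - m := Nat.cast_sub hm
  rw [← h2]
  exact_mod_cast this

/-- The sum over lattice paths with `m` double steps and `p - m` single steps of the products of the
heights of the single steps. -/
def risingWeight (τ : ℂ) (p : ℕ) (x : ℂ) (m : ℕ) : ℂ :=
  p.choose m * stepPoch (x + m * τ) τ (p - m)

theorem risingWeight_succ_zero (τ : ℂ) (p : ℕ) (x : ℂ) :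
    risingWeight τ (p + 1) x 0 = x * risingWeight τ p (x + τ) 0 := by
  simp [risingWeight, stepPoch_succ']

/-- Split the paths by their first step: a single step has weight `x` and climbs to `x + τ`, a
double step has weight 1 and climbs to `x + 2τ`. -/
theorem risingWeight_succ_succ (τ : ℂ) {p m : ℕ} (hm : m ≤ p) (x : ℂ) :
    risingWeight τ (p + 1) x (m + 1) =
      x * risingWeight τ p (x + τ) (m + 1) + risingWeight τ p (x + 2 * τ) m := by
  rcases hm.eq_or_lt with rfl | hlt
  · simp [risingWeight, stepPoch_zero]
  obtain ⟨d, rfl⟩ := Nat.exists_eq_add_of_lt hlt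
  have e1 : m + d + 1 + 1 - (m + 1) = d + 1 := by omega
  have e2 : m + d + 1 - (m + 1) = d := by omega
  have e3 : m + d + 1 - m = d + 1 := by omega
  have hc := choose_succ_right_mul (m + d + 1) m hm
  simp only [risingWeight, e1, e2, e3]
  rw [Nat.choose_succ_succ' (m + d + 1) m, stepPoch_succ', stepPoch_succ]
  have a1 : x + τ + ((m + 1 : ℕ) : ℂ) * τ = x + 2 * τ + m * τ := by push_cast; ring
  have a2 : x + ((m + 1 : ℕ) : ℂ) * τ + τ = x + 2 * τ + m * τ := by push_cast; ring
  rw [a1, a2]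
  push_cast at hc ⊢
  linear_combination (τ * stepPoch (x + 2 * τ + m * τ) τ d) * hc

/-- The sum over lattice paths with `w` rising steps and `q - w` falling steps of the products of the
inverse heights of the steps. -/
def fallingWeight (τ : ℂ) (q : ℕ) (x : ℂ) (w : ℕ) : ℂ :=
  q.choose w * (stepPoch (x - (q - w) * τ) τ w)⁻¹ *
    (stepPoch (x + (2 * w - q + 1) * τ) τ (q - w))⁻¹

theorem fallingWeight_succ_zero (τ : ℂ) (q : ℕ) {x : ℂ} (hx : x ≠ 0) :
    x * fallingWeight τ (q + 1) x 0 = fallingWeight τ q (x - τ) 0 := by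
  simp only [fallingWeight, Nat.sub_zero, stepPoch_succ, Nat.choose_zero_right, stepPoch_zero]
  have a1 : x + (2 * ((0 : ℕ) : ℂ) - ((q + 1 : ℕ) : ℂ) + 1) * τ =
      x - τ + (2 * ((0 : ℕ) : ℂ) - q + 1) * τ := by push_cast; ring
  have a2 : x - τ + (2 * ((0 : ℕ) : ℂ) - q + 1) * τ + q * τ = x := by push_cast; ring
  rw [a1, a2, mul_inv]
  field_simp

/-- Split the paths by their first step, up to `x + τ` or down to `x - τ`, either with weight `1 /
x`. The two extreme heights must be nonzero only when both kinds of path occur; for `w = q` the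
downward term has binomial coefficient 0. -/
theorem fallingWeight_succ_succ (τ : ℂ) {q w : ℕ} (hw : w ≤ q) {x : ℂ} (hx : x ≠ 0)
    (hlow : w < q → x - (q - w) * τ ≠ 0) (hhigh : w < q → x + (w + 1) * τ ≠ 0) :
    x * fallingWeight τ (q + 1) x (w + 1) =
      fallingWeight τ q (x + τ) w + fallingWeight τ q (x - τ) (w + 1) := by
  rcases hw.eq_or_lt with rfl | hlt
  · simp only [fallingWeight, Nat.choose_succ_self, Nat.choose_self, Nat.sub_self, stepPoch_zero,
      stepPoch_succ']
    push_cast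
    simp only [sub_self, zero_mul, sub_zero, mul_inv]
    field_simp
    ring
  obtain ⟨d, rfl⟩ := Nat.exists_eq_add_of_lt hlt
  have e1 : w + d + 1 + 1 - (w + 1) = d + 1 := by omega
  have e2 : w + d + 1 - (w + 1) = d := by omega
  have e3 : w + d + 1 - w = d + 1 := by omega
  have hc := choose_succ_right_mul (w + d + 1) w hw
  simp only [fallingWeight, e1, e2, e3]
  specialize hlow hlt
  specialize hhigh hlt
  have a1 : x - (((w + d + 1 + 1 : ℕ) : ℂ) - ((w + 1 : ℕ) : ℂ)) * τ = x - (d + 1) * τ := by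
    push_cast; ring
  have a2 : x + τ - (((w + d + 1 : ℕ) : ℂ) - (w : ℂ)) * τ = x - (d + 1) * τ + τ := by
    push_cast; ring
  have a3 : x - τ - (((w + d + 1 : ℕ) : ℂ) - ((w + 1 : ℕ) : ℂ)) * τ = x - (d + 1) * τ := by
    push_cast; ring
  have b1 : x + (2 * ((w + 1 : ℕ) : ℂ) - ((w + d + 1 + 1 : ℕ) : ℂ) + 1) * τ =
      x + (w - d + 1) * τ := by push_cast; ring
  have b2 : x + τ + (2 * (w : ℂ) - ((w + d + 1 : ℕ) : ℂ) + 1) * τ = x + (w - d + 1) * τ := by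
    push_cast; ring
  have b3 : x - τ + (2 * ((w + 1 : ℕ) : ℂ) - ((w + d + 1 : ℕ) : ℂ) + 1) * τ =
      x + (w - d + 1) * τ := by push_cast; ring
  rw [a1, a2, a3, b1, b2, b3, Nat.choose_succ_succ' (w + d + 1) w, stepPoch_succ _ _ d,
    stepPoch_succ' _ _ w]
  have hy : x - (d + 1) * τ ≠ 0 := by
    convert hlow using 2
    push_cast; ring
  have hv : x + (w - d + 1) * τ + d * τ = x + (w + 1) * τ := by ring
  -- `v` and `y` are the highest and lowest heights reached. With q = w + d + 1, clearing them
  -- leaves (C(q,w) + C(q,w+1)) x = C(q,w) y + C(q,w+1) v.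
  obtain ⟨v, hv'⟩ : ∃ v, v = x + (w + 1) * τ := ⟨_, rfl⟩
  obtain ⟨y, hy'⟩ : ∃ y, y = x - (d + 1) * τ := ⟨_, rfl⟩
  rw [← hv'] at hhigh
  rw [hv, ← hv', ← hy']
  rw [← hy'] at hy
  simp only [mul_inv]
  generalize (stepPoch (y + τ) τ w)⁻¹ = A
  generalize (stepPoch (x + (w - d + 1) * τ) τ d)⁻¹ = B
  field_simp
  push_cast at hc ⊢
  linear_combination (-(A * B * τ)) * hc - (A * B * (w + d + 1).choose w) * hy' -
    (A * B * (w + d + 1).choose (w + 1)) * hv'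

/-! ### Solving the two recursions -/

namespace SelbergParams

namespace BlockRelations

variable {n : ℕ} {α₁ α₂ α₃ τ b c : ℂ} {f : ℕ → ℕ → ℕ → ℕ → ℂ}

/-- With no `ac` present, `linear` and `parts` at q = 0 both involve f(p, 1, s, t); this is the
result of eliminating it. -/
theorem lower_step (h : BlockRelations n α₁ α₂ α₃ τ b c f) {p s t : ℕ} (hn : p + s + t + 1 = n) :
    (α₁ + α₂ + α₃ + (2 * n - 2 - p) * τ) * f (p + 1) 0 s t =
      (α₁ + α₂ + (s + 2 * t) * τ) * c * f p 0 (s + 1) t -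
        (α₂ + t * τ) * b * f p 0 s (t + 1) := by
  have h1 := h.linear p 0 s t (by omega)
  have h2 := h.parts p 0 s t (by omega)
  have hn' : (n : ℂ) = p + s + t + 1 := by exact_mod_cast hn.symm
  rw [hn']
  push_cast at h2
  linear_combination (-1) * h2 + (α₁ + α₂ + (s + 2 * t) * τ) * h1

theorem upper_step (h : BlockRelations n α₁ α₂ α₃ τ b c f) {p q t : ℕ} (hn : p + q + t + 1 = n) :
    (α₁ + α₂ + (q + 2 * t) * τ) * f p (q + 1) 0 t =
      (α₁ + t * τ) * b * f p q 0 (t + 1) - (α₃ + p * τ) * f (p + 1) q 0 t := by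
  have h2 := h.parts p q 0 t (by omega)
  push_cast at h2
  linear_combination (-1) * h2

/-- Iterating `lower_step`, turning `ab` into `b` raises the height α₁ + α₂ + (s + 2t)τ by τ,
turning it into `c` raises it by 2τ. Only the first move carries the height as a factor, so the sum
over orders of moves is `risingWeight`. The remaining factors depend only on the number m of moves
to `c`. -/
theorem lower_expansion (h : BlockRelations n α₁ α₂ α₃ τ b c f) (p : ℕ) :
    ∀ s t : ℕ, p + s + t = n →
      (∏ r ∈ Finset.range p, (α₁ + α₂ + α₃ + (2 * n - 2 - r) * τ)) * f p 0 s t =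
        ∑ m ∈ Finset.range (p + 1), (-b) ^ m * c ^ (p - m) * stepPoch (α₂ + t * τ) τ m *
          risingWeight τ p (α₁ + α₂ + (s + 2 * t) * τ) m * f 0 0 (p + s - m) (t + m) := by
  induction p with
  | zero =>
    intro s t _
    simp [stepPoch_zero, risingWeight]
  | succ p ih =>
    intro s t hn
    have e1 := ih (s + 1) t (by omega)
    have e2 := ih s (t + 1) (by omega)
    have hstep := h.lower_step (p := p) (s := s) (t := t) (by omega)
    have hsum1 : ∑ m ∈ Finset.range (p + 1), (-b) ^ m * c ^ (p - m) * stepPoch (α₂ + t * τ) τ m *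
          risingWeight τ p (α₁ + α₂ + ((s + 1 : ℕ) + 2 * t) * τ) m *
            f 0 0 (p + (s + 1) - m) (t + m) =
        ∑ m ∈ Finset.range (p + 1), (-b) ^ (m + 1) * c ^ (p - (m + 1)) *
          stepPoch (α₂ + t * τ) τ (m + 1) *
          risingWeight τ p (α₁ + α₂ + ((s + 1 : ℕ) + 2 * t) * τ) (m + 1) *
            f 0 0 (p + (s + 1) - (m + 1)) (t + (m + 1)) +
        c ^ p * risingWeight τ p (α₁ + α₂ + ((s + 1 : ℕ) + 2 * t) * τ) 0 * f 0 0 (p + (s + 1)) t := by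
      rw [Finset.sum_range_succ', Finset.sum_range_succ _ p]
      simp [risingWeight, stepPoch_zero]
    rw [hsum1] at e1
    rw [Finset.prod_range_succ, mul_assoc, hstep, mul_sub, Finset.sum_range_succ']
    have hsum : ∑ m ∈ Finset.range (p + 1), (-b) ^ (m + 1) * c ^ (p + 1 - (m + 1)) *
          stepPoch (α₂ + t * τ) τ (m + 1) *
          risingWeight τ (p + 1) (α₁ + α₂ + (s + 2 * t) * τ) (m + 1) *
            f 0 0 (p + 1 + s - (m + 1)) (t + (m + 1)) =
        (α₁ + α₂ + (s + 2 * t) * τ) * c *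
        (∑ m ∈ Finset.range (p + 1), (-b) ^ (m + 1) * c ^ (p - (m + 1)) *
          stepPoch (α₂ + t * τ) τ (m + 1) *
          risingWeight τ p (α₁ + α₂ + ((s + 1 : ℕ) + 2 * t) * τ) (m + 1) *
            f 0 0 (p + (s + 1) - (m + 1)) (t + (m + 1))) -
        (α₂ + t * τ) * b *
        ∑ m ∈ Finset.range (p + 1), (-b) ^ m * c ^ (p - m) *
          stepPoch (α₂ + (t + 1 : ℕ) * τ) τ m *
          risingWeight τ p (α₁ + α₂ + (s + 2 * (t + 1 : ℕ)) * τ) m *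
            f 0 0 (p + s - m) (t + 1 + m) := by
      rw [Finset.mul_sum, Finset.mul_sum, ← Finset.sum_sub_distrib]
      refine Finset.sum_congr rfl fun m hm => ?_
      have hm' : m ≤ p := Nat.lt_succ_iff.1 (Finset.mem_range.1 hm)
      have i1 : p + 1 + s - (m + 1) = p + s - m := by omega
      have i2 : p + (s + 1) - (m + 1) = p + s - m := by omega
      have i3 : t + 1 + m = t + (m + 1) := by omega
      have i4 : p + 1 - (m + 1) = p - m := by omega
      have x1 : α₁ + α₂ + (((s + 1 : ℕ) : ℂ) + 2 * t) * τ = α₁ + α₂ + (s + 2 * t) * τ + τ := by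
        push_cast; ring
      have x2 : α₁ + α₂ + ((s : ℂ) + 2 * (t + 1 : ℕ)) * τ =
          α₁ + α₂ + (s + 2 * t) * τ + 2 * τ := by push_cast; ring
      have x3 : α₂ + ((t + 1 : ℕ) : ℂ) * τ = α₂ + t * τ + τ := by push_cast; ring
      -- For m = p the truncated exponent `p - (m + 1)` loses a factor `c`, but then `risingWeight`
      -- is 0 because its binomial coefficient is.
      have hcp : c ^ (p - m) * risingWeight τ p (α₁ + α₂ + (s + 2 * t) * τ + τ) (m + 1) =
          c * c ^ (p - (m + 1)) * risingWeight τ p (α₁ + α₂ + (s + 2 * t) * τ + τ) (m + 1) := by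
        rcases hm'.eq_or_lt with rfl | hlt
        · simp [risingWeight]
        · rw [← pow_succ', show p - (m + 1) + 1 = p - m by omega]
      rw [i1, i2, i3, i4, x1, x2, x3, risingWeight_succ_succ τ hm', stepPoch_succ', pow_succ]
      linear_combination ((-b) ^ m * (-b) * ((α₂ + t * τ) * stepPoch (α₂ + t * τ + τ) τ m) *
        (α₁ + α₂ + (s + 2 * t) * τ) * f 0 0 (p + s - m) (t + (m + 1))) * hcp
    have x1 : α₁ + α₂ + (((s + 1 : ℕ) : ℂ) + 2 * t) * τ = α₁ + α₂ + (s + 2 * t) * τ + τ := by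
      push_cast; ring
    rw [hsum, risingWeight_succ_zero, ← x1]
    simp only [pow_zero, Nat.sub_zero, stepPoch_zero, add_zero, one_mul, mul_one]
    rw [show p + 1 + s = p + (s + 1) by omega, pow_succ]
    linear_combination ((α₁ + α₂ + (s + 2 * t) * τ) * c) * e1 - ((α₂ + t * τ) * b) * e2

/-- Each use of `upper_step` divides by the current height; turning `ac` into `c` raises the next
height by τ, turning it into `ab` lowers it by τ. The sum over orders of moves is `fallingWeight`,
with w the number of moves to `c`. -/
theorem upper_expansion (h : BlockRelations n α₁ α₂ α₃ τ b c f)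
    (hden : ∀ s : ℕ, s + 2 ≤ 2 * n → α₁ + α₂ + s * τ ≠ 0) (q : ℕ) :
    ∀ p t : ℕ, p + q + t = n → f p q 0 t =
      ∑ w ∈ Finset.range (q + 1), (-1) ^ (q - w) * b ^ w * stepPoch (α₁ + t * τ) τ w *
        stepPoch (α₃ + p * τ) τ (q - w) * fallingWeight τ q (α₁ + α₂ + (q - 1 + 2 * t) * τ) w *
          f (p + (q - w)) 0 0 (t + w) := by
  induction q with
  | zero =>
    intro p t _
    simp [stepPoch_zero, fallingWeight]
  | succ q ih =>
    intro p t hn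
    have hx : α₁ + α₂ + (q + 2 * t) * τ ≠ 0 := by
      have := hden (q + 2 * t) (by omega)
      push_cast at this
      exact this
    have e1 := ih p (t + 1) (by omega)
    have e2 := ih (p + 1) t (by omega)
    have hstep := h.upper_step (p := p) (q := q) (t := t) (by omega)
    have x0 : α₁ + α₂ + (((q + 1 : ℕ) : ℂ) - 1 + 2 * t) * τ = α₁ + α₂ + (q + 2 * t) * τ := by
      push_cast; ring
    have x1 : α₁ + α₂ + ((q : ℂ) - 1 + 2 * ((t + 1 : ℕ) : ℂ)) * τ =
        α₁ + α₂ + (q + 2 * t) * τ + τ := by push_cast; ring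
    have x2 : α₁ + α₂ + ((q : ℂ) - 1 + 2 * t) * τ = α₁ + α₂ + (q + 2 * t) * τ - τ := by ring
    rw [x1] at e1
    rw [x2] at e2
    rw [x0]
    set x := α₁ + α₂ + (q + 2 * t) * τ with hxdef
    have hsum2 : ∑ w ∈ Finset.range (q + 1), (-1) ^ (q - w) * b ^ w * stepPoch (α₁ + t * τ) τ w *
        stepPoch (α₃ + (p + 1 : ℕ) * τ) τ (q - w) * fallingWeight τ q (x - τ) w *
          f (p + 1 + (q - w)) 0 0 (t + w) =
        ∑ w ∈ Finset.range (q + 1), (-1) ^ (q - (w + 1)) * b ^ (w + 1) *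
          stepPoch (α₁ + t * τ) τ (w + 1) *
          stepPoch (α₃ + (p + 1 : ℕ) * τ) τ (q - (w + 1)) * fallingWeight τ q (x - τ) (w + 1) *
          f (p + 1 + (q - (w + 1))) 0 0 (t + (w + 1)) +
        (-1) ^ q * stepPoch (α₃ + (p + 1 : ℕ) * τ) τ q * fallingWeight τ q (x - τ) 0 *
          f (p + 1 + q) 0 0 t := by
      rw [Finset.sum_range_succ', Finset.sum_range_succ _ q]
      simp [fallingWeight, stepPoch_zero]
    rw [hsum2] at e2
    refine mul_left_cancel₀ hx ?_
    rw [hstep, Finset.sum_range_succ', mul_add, Finset.mul_sum]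
    have hp : α₃ + ((p + 1 : ℕ) : ℂ) * τ = α₃ + p * τ + τ := by push_cast; ring
    have ht : α₁ + ((t + 1 : ℕ) : ℂ) * τ = α₁ + t * τ + τ := by push_cast; ring
    have hsum : ∑ w ∈ Finset.range (q + 1), x * ((-1) ^ (q + 1 - (w + 1)) * b ^ (w + 1) *
        stepPoch (α₁ + t * τ) τ (w + 1) * stepPoch (α₃ + p * τ) τ (q + 1 - (w + 1)) *
        fallingWeight τ (q + 1) x (w + 1) * f (p + (q + 1 - (w + 1))) 0 0 (t + (w + 1))) =
        (α₁ + t * τ) * b * (∑ w ∈ Finset.range (q + 1), (-1) ^ (q - w) * b ^ w *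
          stepPoch (α₁ + (t + 1 : ℕ) * τ) τ w * stepPoch (α₃ + p * τ) τ (q - w) *
          fallingWeight τ q (x + τ) w * f (p + (q - w)) 0 0 (t + 1 + w)) -
        (α₃ + p * τ) * ∑ w ∈ Finset.range (q + 1), (-1) ^ (q - (w + 1)) * b ^ (w + 1) *
          stepPoch (α₁ + t * τ) τ (w + 1) *
          stepPoch (α₃ + (p + 1 : ℕ) * τ) τ (q - (w + 1)) * fallingWeight τ q (x - τ) (w + 1) *
          f (p + 1 + (q - (w + 1))) 0 0 (t + (w + 1)) := by
      rw [Finset.mul_sum, Finset.mul_sum, ← Finset.sum_sub_distrib]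
      refine Finset.sum_congr rfl fun w hw => ?_
      have hw' : w ≤ q := Nat.lt_succ_iff.1 (Finset.mem_range.1 hw)
      have i1 : q + 1 - (w + 1) = q - w := by omega
      have i3 : t + 1 + w = t + (w + 1) := by omega
      have hV := fallingWeight_succ_succ τ hw' hx
        (fun hlt => by
          have := hden (2 * t + w) (by omega)
          rw [hxdef]
          convert this using 1
          push_cast; ring)
        (fun hlt => by
          have := hden (q + 2 * t + w + 1) (by omega)
          rw [hxdef]
          convert this using 1
          push_cast; ring)
      -- At w = q the truncated index `q - (w + 1)` is harmless, since `fallingWeight` vanishes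
      -- there.
      have hcp : (-1) ^ (q - w) * stepPoch (α₃ + p * τ) τ (q - w) *
            fallingWeight τ q (x - τ) (w + 1) * f (p + (q - w)) 0 0 (t + (w + 1)) =
          -((-1) ^ (q - (w + 1)) * ((α₃ + p * τ) * stepPoch (α₃ + p * τ + τ) τ (q - (w + 1))) *
            fallingWeight τ q (x - τ) (w + 1) * f (p + 1 + (q - (w + 1))) 0 0 (t + (w + 1))) := by
        rcases hw'.eq_or_lt with rfl | hlt
        · simp [fallingWeight]
        · obtain ⟨d, rfl⟩ := Nat.exists_eq_add_of_lt hlt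
          have j1 : w + d + 1 - w = d + 1 := by omega
          have j2 : w + d + 1 - (w + 1) = d := by omega
          rw [j1, j2, stepPoch_succ', pow_succ, show p + (d + 1) = p + 1 + d by omega]
          ring
      rw [i1, i3, hp, ht]
      have hA := stepPoch_succ' (α₁ + t * τ) τ w
      calc _ = (-1) ^ (q - w) * b ^ (w + 1) * stepPoch (α₁ + t * τ) τ (w + 1) *
            stepPoch (α₃ + p * τ) τ (q - w) * f (p + (q - w)) 0 0 (t + (w + 1)) *
            (x * fallingWeight τ (q + 1) x (w + 1)) := by ring
        _ = _ := by
          rw [hV]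
          linear_combination (b ^ (w + 1) * stepPoch (α₁ + t * τ) τ (w + 1)) * hcp +
            ((-1) ^ (q - w) * b ^ (w + 1) * stepPoch (α₃ + p * τ) τ (q - w) *
              f (p + (q - w)) 0 0 (t + (w + 1)) * fallingWeight τ q (x + τ) w) * hA
    rw [hsum]
    have hV0 := fallingWeight_succ_zero τ q hx
    have hB := stepPoch_succ' (α₃ + p * τ) τ q
    rw [hp] at e2
    rw [← hV0] at e2
    simp only [pow_zero, Nat.sub_zero, stepPoch_zero, add_zero, mul_one, hB, hp]
    rw [show p + (q + 1) = p + 1 + q by omega, pow_succ]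
    linear_combination ((α₁ + t * τ) * b) * e1 - (α₃ + p * τ) * e2

end BlockRelations

end SelbergParams

/-! ### Matching the expansions with L, D and U -/

namespace SelbergParams

variable (P : SelbergParams) {n : ℕ}

/-- `lower_expansion` at p = n - k, s = 0, t = k, divided by the product on its left. The part of
`diagEntry` not used up in this division is the coefficient on the right. -/
theorem sum_mul_matL_mul_diagEntry (hden : P.DenominatorsNonzero n) {f : ℕ → ℕ → ℕ → ℕ → ℂ}
    (h : BlockRelations n P.α₁ P.α₂ P.α₃ P.τ ((P.x₂ - P.x₁ : ℝ) : ℂ) ((P.x₃ - P.x₁ : ℝ) : ℂ) f)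
    (k : Fin (n + 1)) :
    (∑ i : Fin (n + 1), f 0 0 (n - i) i * P.matL n i k) * P.diagEntry n k =
      stepPoch P.α₁ P.τ k * ((P.x₂ - P.x₁ : ℝ) : ℂ) ^ (k : ℕ) *
        (stepPoch (P.α₁ + P.α₂ + ((k : ℂ) - 1) * P.τ) P.τ k)⁻¹ * f (n - k) 0 0 k := by
  obtain ⟨hx, h12, h123⟩ := hden
  obtain ⟨k, hk⟩ := k
  obtain ⟨p, rfl⟩ := Nat.exists_eq_add_of_le (Nat.lt_succ_iff.1 hk)
  simp only
  set b : ℂ := ((P.x₂ - P.x₁ : ℝ) : ℂ) with hb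
  set c : ℂ := ((P.x₃ - P.x₁ : ℝ) : ℂ) with hc
  have hc0 : c ≠ 0 := Complex.ofReal_ne_zero.2 (sub_ne_zero.2 hx)
  have hlow := h.lower_expansion p 0 k (by omega)
  have hprod : ∏ r ∈ Finset.range p, (P.α₁ + P.α₂ + P.α₃ + (2 * ((k + p : ℕ) : ℂ) - 2 - r) * P.τ) =
      stepPoch (P.α₁ + P.α₂ + P.α₃ + (((k + p : ℕ) : ℂ) + (k : ℂ) - 1) * P.τ) P.τ p := by
    -- The recursion collects its factors from 2n - 2 downwards; reversed, they rise from n + k - 1.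
    rw [stepPoch, ← Finset.prod_range_reflect]
    refine Finset.prod_congr rfl fun r hr => ?_
    have hr' : r < p := Finset.mem_range.1 hr
    have : ((p - 1 - r : ℕ) : ℂ) = p - 1 - r := by
      rw [Nat.cast_sub (by omega), Nat.cast_sub (by omega)]
      simp
    rw [this]
    push_cast
    ring
  have hδ : stepPoch (P.α₁ + P.α₂ + P.α₃ + (((k + p : ℕ) : ℂ) + (k : ℂ) - 1) * P.τ) P.τ p ≠ 0 := by
    refine stepPoch_ne_zero fun s hs => ?_
    have := h123 (k + p + k - 1 + s) (by omega) (by omega)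
    have hcast : ((k + p + k - 1 + s : ℕ) : ℂ) = k + p + k - 1 + s := by
      rw [Nat.cast_add, Nat.cast_sub (by omega)]
      push_cast
      ring
    rw [hcast] at this
    convert this using 1
    push_cast
    ring
  have hsum : ∑ i : Fin (k + p + 1), f 0 0 (k + p - i) i * P.matL (k + p) i ⟨k, hk⟩ =
      ∑ m ∈ Finset.range (p + 1), f 0 0 (p - m) (k + m) * ((-1) ^ m * (p.choose m : ℂ) *
        (stepPoch (P.α₂ + k * P.τ) P.τ m / stepPoch (P.α₁ + P.α₂ + 2 * k * P.τ) P.τ m) *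
        (b / c) ^ m) := by
    obtain ⟨F, hF⟩ : ∃ F : ℕ → ℂ, F = fun i : ℕ => if k ≤ i then f 0 0 (k + p - i) i *
        ((-1) ^ (i - k) * (((k + p - k).choose (k + p - i) : ℕ) : ℂ) *
          (stepPoch (P.α₂ + k * P.τ) P.τ (i - k) /
            stepPoch (P.α₁ + P.α₂ + 2 * k * P.τ) P.τ (i - k)) * (b / c) ^ (i - k)) else 0 :=
      ⟨_, rfl⟩
    have h1 : ∀ i : Fin (k + p + 1), f 0 0 (k + p - i) i * P.matL (k + p) i ⟨k, hk⟩ = F i := by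
      intro i
      simp only [hF, matL, Fin.le_def, mul_ite, mul_zero]
      rw [hb, hc, Complex.ofReal_div]
    rw [Finset.sum_congr rfl fun i _ => h1 i, Fin.sum_univ_eq_sum_range F, add_assoc,
      Finset.sum_range_add, Finset.sum_eq_zero, zero_add]
    · refine Finset.sum_congr rfl fun m hm => ?_
      have hm' : m ≤ p := Nat.lt_succ_iff.1 (Finset.mem_range.1 hm)
      simp only [hF]
      rw [if_pos (Nat.le_add_right k m), Nat.add_sub_cancel_left, Nat.add_sub_cancel_left,
        Nat.add_sub_add_left, Nat.choose_symm hm']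
    · intro i hi
      rw [hF]
      exact if_neg (not_le.2 (Finset.mem_range.1 hi))
  rw [hsum, diagEntry]
  simp only [Nat.add_sub_cancel_left]
  rw [hprod] at hlow
  have hterm : ∀ m ∈ Finset.range (p + 1), f 0 0 (p - m) (k + m) * ((-1) ^ m * (p.choose m : ℂ) *
      (stepPoch (P.α₂ + k * P.τ) P.τ m / stepPoch (P.α₁ + P.α₂ + 2 * k * P.τ) P.τ m) *
        (b / c) ^ m) * (stepPoch (P.α₁ + P.α₂ + 2 * k * P.τ) P.τ p * c ^ p) =
      (-b) ^ m * c ^ (p - m) * stepPoch (P.α₂ + k * P.τ) P.τ m *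
          risingWeight P.τ p (P.α₁ + P.α₂ + ((0 : ℕ) + 2 * k) * P.τ) m *
            f 0 0 (p + 0 - m) (k + m) := by
    intro m hm
    have hm' : m ≤ p := Nat.lt_succ_iff.1 (Finset.mem_range.1 hm)
    obtain ⟨d, rfl⟩ := Nat.exists_eq_add_of_le hm'
    have hne : stepPoch (P.α₁ + P.α₂ + 2 * k * P.τ) P.τ m ≠ 0 := by
      refine stepPoch_ne_zero fun s hs => ?_
      have := h12 (2 * k + s) (by omega)
      convert this using 1
      push_cast
      ring
    have e1 : P.α₁ + P.α₂ + (((0 : ℕ) : ℂ) + 2 * k) * P.τ = P.α₁ + P.α₂ + 2 * k * P.τ := by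
      push_cast; ring
    have hneg : (-b) ^ m = (-1) ^ m * b ^ m := neg_pow b m
    -- Splitting the rising product of length p after m factors cancels the denominator of `matL`
    -- and leaves the rising product in `risingWeight`.
    rw [e1, risingWeight, Nat.add_sub_cancel_left, stepPoch_add, pow_add, hneg, div_pow, add_zero,
      Nat.add_sub_cancel_left]
    generalize stepPoch (P.α₁ + P.α₂ + 2 * k * P.τ) P.τ m = X at hne ⊢
    generalize stepPoch (P.α₁ + P.α₂ + 2 * k * P.τ + m * P.τ) P.τ d = Y
    field_simp
  have hlow' := (Finset.sum_congr rfl hterm).trans hlow.symm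
  rw [← Finset.sum_mul] at hlow'
  generalize ∑ m ∈ Finset.range (p + 1), f 0 0 (p - m) (k + m) * ((-1) ^ m * (p.choose m : ℂ) *
    (stepPoch (P.α₂ + k * P.τ) P.τ m / stepPoch (P.α₁ + P.α₂ + 2 * k * P.τ) P.τ m) *
        (b / c) ^ m) = S at hlow' ⊢
  rw [← hb, ← hc, ← div_div, div_eq_mul_inv _ (stepPoch (P.α₁ + P.α₂ + P.α₃ + _) _ _)]
  rw [mul_comm (stepPoch (P.α₁ + P.α₂ + P.α₃ + _) _ _)] at hlow'
  rw [(eq_mul_inv_iff_mul_eq₀ hδ).2 hlow'.symm]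
  ring

/-- `upper_expansion` at p = n - j, q = j, t = 0. The first inverse product in `fallingWeight`
belongs to the diagonal coefficient, the second to `matU`. -/
theorem eq_sum_mul_matU (hden : P.DenominatorsNonzero n) {f : ℕ → ℕ → ℕ → ℕ → ℂ} {b c : ℂ}
    (h : BlockRelations n P.α₁ P.α₂ P.α₃ P.τ b c f) (j : Fin (n + 1)) :
    f (n - j) j 0 0 = ∑ k : Fin (n + 1), stepPoch P.α₁ P.τ k * b ^ (k : ℕ) *
      (stepPoch (P.α₁ + P.α₂ + ((k : ℂ) - 1) * P.τ) P.τ k)⁻¹ * f (n - k) 0 0 k * P.matU n k j := by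
  obtain ⟨j, hj⟩ := j
  obtain ⟨p, rfl⟩ := Nat.exists_eq_add_of_le (Nat.lt_succ_iff.1 hj)
  have hup := h.upper_expansion hden.2.1 j p 0 (by omega)
  simp only [Nat.add_sub_cancel_left]
  obtain ⟨F, hF⟩ : ∃ F : ℕ → ℂ, F = fun k : ℕ => if k ≤ j then stepPoch P.α₁ P.τ k * b ^ k *
      (stepPoch (P.α₁ + P.α₂ + ((k : ℂ) - 1) * P.τ) P.τ k)⁻¹ * f (j + p - k) 0 0 k *
        ((-1) ^ (j - k) * ((j.choose k : ℕ) : ℂ) *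
          (stepPoch (P.α₃ + (((j + p : ℕ) : ℂ) - j) * P.τ) P.τ (j - k) /
            stepPoch (P.α₁ + P.α₂ + 2 * k * P.τ) P.τ (j - k))) else 0 := ⟨_, rfl⟩
  have h1 : ∀ k : Fin (j + p + 1), stepPoch P.α₁ P.τ k * b ^ (k : ℕ) *
      (stepPoch (P.α₁ + P.α₂ + ((k : ℂ) - 1) * P.τ) P.τ k)⁻¹ * f (j + p - k) 0 0 k *
        P.matU (j + p) k ⟨j, hj⟩ = F k := by
    intro k
    simp only [hF, matU, Fin.le_def, mul_ite, mul_zero]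
  rw [Finset.sum_congr rfl fun k _ => h1 k, Fin.sum_univ_eq_sum_range F,
    show j + p + 1 = (j + 1) + p by omega, Finset.sum_range_add]
  have hzero : ∑ x ∈ Finset.range p, F (j + 1 + x) = 0 :=
    Finset.sum_eq_zero fun x _ => by
      rw [hF]
      exact if_neg (by omega)
  rw [hzero, add_zero, hup]
  refine Finset.sum_congr rfl fun k hk => ?_
  have hk' : k ≤ j := Nat.lt_succ_iff.1 (Finset.mem_range.1 hk)
  simp only [hF]
  rw [if_pos hk', fallingWeight, Nat.zero_add, show p + (j - k) = j + p - k by omega]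
  have e1 : P.α₁ + P.α₂ + ((j : ℂ) - 1 + 2 * ((0 : ℕ) : ℂ)) * P.τ - ((j : ℂ) - k) * P.τ =
      P.α₁ + P.α₂ + ((k : ℂ) - 1) * P.τ := by push_cast; ring
  have e2 : P.α₁ + P.α₂ + ((j : ℂ) - 1 + 2 * ((0 : ℕ) : ℂ)) * P.τ + (2 * (k : ℂ) - j + 1) * P.τ =
      P.α₁ + P.α₂ + 2 * k * P.τ := by push_cast; ring
  have e3 : P.α₃ + (((j + p : ℕ) : ℂ) - j) * P.τ = P.α₃ + p * P.τ := by push_cast; ring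
  have e4 : P.α₁ + ((0 : ℕ) : ℂ) * P.τ = P.α₁ := by simp
  rw [e1, e2, e3, e4, div_eq_mul_inv]
  ring

theorem vecMul_matA (hden : P.DenominatorsNonzero n) {f : ℕ → ℕ → ℕ → ℕ → ℂ}
    (h : BlockRelations n P.α₁ P.α₂ P.α₃ P.τ ((P.x₂ - P.x₁ : ℝ) : ℂ) ((P.x₃ - P.x₁ : ℝ) : ℂ) f) :
    Matrix.vecMul (fun i : Fin (n + 1) => f 0 0 (n - i) i) (P.matA n) =
      fun j : Fin (n + 1) => f (n - j) j 0 0 := by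
  funext j
  rw [P.eq_sum_mul_matU hden h j, matA, ← Matrix.vecMul_vecMul, ← Matrix.vecMul_vecMul, matD,
    Matrix.vecMul, dotProduct]
  refine Finset.sum_congr rfl fun k _ => ?_
  rw [Matrix.vecMul_diagonal, ← P.sum_mul_matL_mul_diagEntry hden h k]
  rfl

/-! ### The polynomials φᵢ, the region and its symmetries -/

/-- The factors of `φᵢ`. -/
def phiWord (n i : ℕ) (l : Fin n) : Factor := if (l : ℕ) + i < n then .b else .c

/-- The factors of `∏ (zₗ - x₁) φᵢ`. -/
def shiftedPhiWord (n i : ℕ) (l : Fin n) : Factor := if (l : ℕ) + i < n then .ab else .ac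

theorem map_univ_ite {α : Type*} {n i : ℕ} (hi : i ≤ n) (x y : α) :
    Finset.univ.val.map (fun l : Fin n => if (l : ℕ) + i < n then x else y) =
      Multiset.replicate (n - i) x + Multiset.replicate i y := by
  obtain ⟨p, rfl⟩ := Nat.exists_eq_add_of_le' hi
  rw [Fin.univ_val_map, Nat.add_sub_cancel, List.ofFn_add]
  simp only [Fin.val_natAdd, Fin.val_castLE]
  rw [← Multiset.coe_add]
  congr 1
  · have : (fun l : Fin p => if (l : ℕ) + i < p + i then x else y) = fun _ => x :=
      funext fun l => if_pos (by have := l.2; omega)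
    rw [this, List.ofFn_const, Multiset.coe_replicate]
  · have : (fun l : Fin i => if p + (l : ℕ) + i < p + i then x else y) = fun _ => y :=
      funext fun l => if_neg (by omega)
    rw [this, List.ofFn_const, Multiset.coe_replicate]

theorem symmetrize_phi (i : ℕ) :
    symmetrize (P.phi i : (Fin n → ℝ) → ℂ) =
      fun z => ((n.factorial : ℂ))⁻¹ * P.symProd (phiWord n i) z := by
  funext z
  rw [symmetrize, symProd]
  congr 1
  refine Finset.sum_congr rfl fun σ _ => Finset.prod_congr rfl fun l _ => ?_
  rw [phiWord]
  split_ifs <;> rfl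

theorem prod_mul_symmetrize_phi (i : ℕ) :
    (fun z : Fin n → ℝ => (∏ l, ((z l - P.x₁ : ℝ) : ℂ)) * symmetrize (P.phi i) z) =
      fun z => ((n.factorial : ℂ))⁻¹ * P.symProd (shiftedPhiWord n i) z := by
  funext z
  rw [symmetrize_phi, mul_left_comm]
  congr 1
  rw [symProd, symProd, Finset.mul_sum]
  refine Finset.sum_congr rfl fun σ _ => ?_
  rw [← Equiv.prod_comp σ fun l => ((z l - P.x₁ : ℝ) : ℂ), ← Finset.prod_mul_distrib]
  refine Finset.prod_congr rfl fun l _ => ?_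
  rw [phiWord, shiftedPhiWord]
  split_ifs <;> rfl

theorem arrangement_eq_zero_of_density_eq_zero {z : Fin n → ℝ} (h : P.density z = 0) :
    P.arrangement z = 0 := by
  by_contra hz
  obtain ⟨h1, h2⟩ := P.arrangement_ne_zero_iff.1 hz
  have habs : ∀ {x y : ℝ} (a : ℂ), y ≠ x → ((|x - y| : ℝ) : ℂ) ^ a ≠ 0 := fun a hxy h0 =>
    abs_ne_zero.2 (sub_ne_zero.2 hxy.symm)
      (Complex.ofReal_eq_zero.1 ((Complex.cpow_eq_zero_iff _ _).1 h0).1)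
  refine mul_ne_zero (Finset.prod_ne_zero_iff.2 fun i _ => mul_ne_zero (mul_ne_zero
    (habs _ (h1 i).1) (habs _ (h1 i).2.1)) (habs _ (h1 i).2.2)) ?_ h
  refine Complex.ofReal_ne_zero.2 (Finset.prod_ne_zero_iff.2 fun j _ =>
    Finset.prod_ne_zero_iff.2 fun k hk => ?_)
  exact (Real.rpow_pos_of_pos (abs_pos.2 (sub_ne_zero.2 (h2 j k (Finset.mem_Ioi.1 hk).ne))) _).ne'

variable {P} in
theorem VanishesOnBoundary.arrangement_eq_zero {Δ : Set (Fin n → ℝ)} (h : P.VanishesOnBoundary Δ)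
    {z : Fin n → ℝ} (hz : z ∈ frontier Δ) : P.arrangement z = 0 := by
  rcases h z hz with h0 | ⟨i, hi⟩
  · exact P.arrangement_eq_zero_of_density_eq_zero h0
  · by_contra hne
    obtain ⟨a1, a2, a3⟩ := (P.arrangement_ne_zero_iff.1 hne).1 i
    rcases hi with h | h | h
    exacts [a1 h, a2 h, a3 h]

variable {P} in
-- The frontier lies in the arrangement, which is a null set. Hence Δ can be replaced by its open
-- interior without assuming it measurable.
theorem VanishesOnBoundary.interior_ae_eq {Δ : Set (Fin n → ℝ)} (h : P.VanishesOnBoundary Δ) :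
    interior Δ =ᵐ[volume] Δ := by
  refine interior_ae_eq_of_null_frontier ?_
  have := P.ae_arrangement_ne_zero (n := n)
  rw [ae_iff] at this
  exact measure_mono_null (fun z hz => not_not.2 (h.arrangement_eq_zero hz)) this

variable {P} in
theorem VanishesOnBoundary.isAdmissible_interior {Δ : Set (Fin n → ℝ)}
    (h : P.VanishesOnBoundary Δ) (hb : Bornology.IsBounded Δ) (hi : IntegrableOn P.density Δ) :
    P.IsAdmissible (interior Δ) where
  isOpen := isOpen_interior
  isBounded := hb.subset interior_subset
  frontier_subset _ hz := h.arrangement_eq_zero (frontier_interior_subset hz)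
  integrableOn := hi.mono_set interior_subset

variable {P} in
theorem VanishesOnBoundary.average_interior {Δ : Set (Fin n → ℝ)} (h : P.VanishesOnBoundary Δ)
    (φ : (Fin n → ℝ) → ℂ) : P.average (interior Δ) φ = P.average Δ φ :=
  setIntegral_congr_set h.interior_ae_eq

/-- The product over pairs j < k is a power of the absolute value of a Vandermonde product, which a
permutation only multiplies by its sign. -/
theorem density_comp_perm (σ : Equiv.Perm (Fin n)) (z : Fin n → ℝ) :
    P.density (fun l => z (σ l)) = P.density z := by
  have hpairs : ∀ y : Fin n → ℝ, ∏ j, ∏ k ∈ Finset.Ioi j, |y j - y k| ^ (2 * P.τ) =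
      |∏ j, ∏ k ∈ Finset.Ioi j, (y j - y k)| ^ (2 * P.τ) := by
    intro y
    rw [Finset.abs_prod, ← Real.finsetProd_rpow _ _ fun j _ => abs_nonneg _]
    refine Finset.prod_congr rfl fun j _ => ?_
    rw [Finset.abs_prod, ← Real.finsetProd_rpow _ _ fun j _ => abs_nonneg _]
  have hsign := σ.prod_Ioi_comp_eq_sign_mul_prod (f := fun i j => z i - z j) (fun i j => by ring)
  rw [density, density, hpairs, hpairs, hsign, abs_mul]
  have habs : |((Equiv.Perm.sign σ : ℤ) : ℝ)| = 1 := by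
    rcases Int.units_eq_one_or (Equiv.Perm.sign σ) with h | h <;> simp [h]
  rw [habs, one_mul]
  congr 1
  exact Equiv.prod_comp σ fun i => ((|P.x₁ - z i| : ℝ) : ℂ) ^ (P.α₁ - 1) *
    ((|P.x₂ - z i| : ℝ) : ℂ) ^ (P.α₂ - 1) * ((|P.x₃ - z i| : ℝ) : ℂ) ^ (P.α₃ - 1)

theorem average_comp_perm {Δ : Set (Fin n → ℝ)}
    (hΔ : ∀ σ : Equiv.Perm (Fin n), ∀ z ∈ Δ, (fun l => z (σ l)) ∈ Δ) (φ : (Fin n → ℝ) → ℂ)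
    (σ : Equiv.Perm (Fin n)) : P.average Δ (fun z => φ fun l => z (σ l)) = P.average Δ φ := by
  have hmp := volume_measurePreserving_piCongrLeft (fun _ : Fin n => ℝ) σ.symm
  have happ : ∀ z : Fin n → ℝ,
      MeasurableEquiv.piCongrLeft (fun _ : Fin n => ℝ) σ.symm z = fun l => z (σ l) := by
    intro z
    funext l
    have := Equiv.piCongrLeft_apply_apply (fun _ : Fin n => ℝ) σ.symm z (σ l)
    simpa [MeasurableEquiv.coe_piCongrLeft] using this
  -- The hypothesis gives one inclusion for each permutation; applied to the inverse permutation it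
  -- gives the other.
  have hpre : (MeasurableEquiv.piCongrLeft (fun _ : Fin n => ℝ) σ.symm) ⁻¹' Δ = Δ := by
    ext z
    rw [Set.mem_preimage, happ]
    refine ⟨fun hz => ?_, hΔ σ z⟩
    simpa using hΔ σ.symm _ hz
  have key := hmp.setIntegral_preimage_emb (MeasurableEquiv.measurableEmbedding _)
    (fun z => φ z * P.density z) Δ
  rw [hpre] at key
  rw [average, average, ← key]
  refine integral_congr_ae (Filter.Eventually.of_forall fun z => ?_)
  simp only [happ, density_comp_perm]

end SelbergParams

/-! ### Symmetrized averages and the difference system -/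

namespace SelbergParams

variable {P : SelbergParams} {n : ℕ}

theorem average_symmetrize {Δ : Set (Fin n → ℝ)} (hvan : P.VanishesOnBoundary Δ)
    (hU : P.IsAdmissible (interior Δ))
    (hΔ : ∀ σ : Equiv.Perm (Fin n), ∀ z ∈ Δ, (fun l => z (σ l)) ∈ Δ) {φ : (Fin n → ℝ) → ℂ}
    (hφ : Continuous φ) : P.average Δ (symmetrize φ) = P.average Δ φ := by
  have hint : ∀ σ : Equiv.Perm (Fin n), Integrable (fun z => φ (fun l => z (σ l)) * P.density z)
      (volume.restrict (interior Δ)) := fun σ => hU.integrableOn_mul (by fun_prop)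
  have hsum : P.average Δ (fun z => ∑ σ : Equiv.Perm (Fin n), φ fun l => z (σ l)) =
      ∑ _σ : Equiv.Perm (Fin n), P.average Δ φ := by
    rw [← hvan.average_interior]
    simp only [average, Finset.sum_mul]
    rw [integral_finsetSum _ fun σ _ => hint σ]
    exact Finset.sum_congr rfl fun σ _ =>
      (hvan.average_interior _).trans (P.average_comp_perm hΔ φ σ)
  have hfac : ((n.factorial : ℕ) : ℂ) ≠ 0 := Nat.cast_ne_zero.2 n.factorial_ne_zero
  change P.average Δ (fun z => ((n.factorial : ℂ))⁻¹ *
    ∑ σ : Equiv.Perm (Fin n), φ fun l => z (σ l)) = _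
  rw [average_const_mul, hsum, Finset.sum_const, Finset.card_univ, Fintype.card_perm,
    Fintype.card_fin, nsmul_eq_mul, inv_mul_cancel_left₀ hfac]

theorem continuous_phi (i : ℕ) : Continuous (P.phi i : (Fin n → ℝ) → ℂ) :=
  continuous_finsetProd _ fun l _ => by split_ifs <;> fun_prop

theorem symmetrize_prod_mul (φ : (Fin n → ℝ) → ℂ) :
    symmetrize (fun z => (∏ l, ((z l - P.x₁ : ℝ) : ℂ)) * φ z) =
      fun z => (∏ l, ((z l - P.x₁ : ℝ) : ℂ)) * symmetrize φ z := by
  funext z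
  rw [symmetrize, symmetrize, mul_left_comm]
  congr 1
  rw [Finset.mul_sum]
  refine Finset.sum_congr rfl fun σ _ => ?_
  rw [Equiv.prod_comp σ fun l => ((z l - P.x₁ : ℝ) : ℂ)]

/-- Both vectors are 1/n! times brackets over the interior, of the blocks (0, 0, n-i, i) and (n-i,
i, 0, 0), so `vecMul_matA` applies. -/
theorem shiftedAverage_symmetrize_eq_vecMul {Δ : Set (Fin n → ℝ)}
    (hden : P.DenominatorsNonzero n) (hvan : P.VanishesOnBoundary Δ)
    (hU : P.IsAdmissible (interior Δ)) :
    (fun i : Fin (n + 1) => P.shiftedAverage Δ (symmetrize (P.phi i))) =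
      Matrix.vecMul (fun i : Fin (n + 1) => P.average Δ (symmetrize (P.phi i))) (P.matA n) := by
  have h1 : ∀ i : Fin (n + 1), P.average Δ (symmetrize (P.phi i)) =
      ((n.factorial : ℂ))⁻¹ * P.bracket (interior Δ) (block 0 0 (n - i) i) := by
    intro i
    have hw : block 0 0 (n - i) i = Finset.univ.val.map (phiWord n i) := by
      rw [show phiWord n i = fun l : Fin n => if (l : ℕ) + i < n then Factor.b else Factor.c from
        rfl, map_univ_ite (Nat.lt_succ_iff.1 i.2)]
      simp [block]
    rw [hw, bracket_map, symmetrize_phi, average_const_mul, hvan.average_interior]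
  have h2 : ∀ i : Fin (n + 1), P.shiftedAverage Δ (symmetrize (P.phi i)) =
      ((n.factorial : ℂ))⁻¹ * P.bracket (interior Δ) (block (n - i) i 0 0) := by
    intro i
    have hw : block (n - i) i 0 0 = Finset.univ.val.map (shiftedPhiWord n i) := by
      rw [show shiftedPhiWord n i =
        fun l : Fin n => if (l : ℕ) + i < n then Factor.ab else Factor.ac from
        rfl, map_univ_ite (Nat.lt_succ_iff.1 i.2)]
      simp [block]
    rw [hw, bracket_map, shiftedAverage, prod_mul_symmetrize_phi, average_const_mul,
      hvan.average_interior]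
  simp only [h1, h2]
  have hA := P.vecMul_matA hden hU.blockRelations
  have := congrArg (fun v => ((n.factorial : ℂ))⁻¹ • v) hA
  simp only [← Matrix.smul_vecMul] at this
  exact this.symm

end SelbergParams

end

theorem theorem2p2 (P : SelbergParams) (n : ℕ) (Δ : Set (Fin n → ℝ))
    (hτ : 0 < P.τ)
    (hden : P.DenominatorsNonzero n)
    (hΔ_bdd : Bornology.IsBounded Δ)
    (hΔ_van : P.VanishesOnBoundary Δ)
    (hΔ_int : IntegrableOn (P.density : (Fin n → ℝ) → ℂ) Δ) :
    -- the system for a region that is invariant under permutations of the coordinates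
    ((∀ σ : Equiv.Perm (Fin n), ∀ z ∈ Δ, (fun l => z (σ l)) ∈ Δ) →
      (fun i : Fin (n + 1) => P.shiftedAverage Δ (P.phi i)) =
        Matrix.vecMul (fun i : Fin (n + 1) => P.average Δ (P.phi i)) (P.matA n)) ∧
    -- the system for an arbitrary region, with symmetrized integrands
    (fun i : Fin (n + 1) => P.shiftedAverage Δ (symmetrize (P.phi i))) =
      Matrix.vecMul (fun i : Fin (n + 1) => P.average Δ (symmetrize (P.phi i))) (P.matA n) := by
  have hU := hΔ_van.isAdmissible_interior hΔ_bdd hΔ_int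
  have hsym := SelbergParams.shiftedAverage_symmetrize_eq_vecMul hden hΔ_van hU
  refine ⟨fun hΔ => ?_, hsym⟩
  have h1 : ∀ i : Fin (n + 1), P.average Δ (symmetrize (P.phi i)) = P.average Δ (P.phi i) :=
    fun i => SelbergParams.average_symmetrize hΔ_van hU hΔ (SelbergParams.continuous_phi i)
  have h2 : ∀ i : Fin (n + 1),
      P.shiftedAverage Δ (symmetrize (P.phi i)) = P.shiftedAverage Δ (P.phi i) := by
    intro i
    rw [SelbergParams.shiftedAverage, ← SelbergParams.symmetrize_prod_mul]
    refine SelbergParams.average_symmetrize hΔ_van hU hΔ (Continuous.mul ?_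
      (SelbergParams.continuous_phi i))
    fun_prop
  simpa only [h1, h2] using hsym
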